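/- Let $\phi\in C^1(\mathbb R)$ be not identically zero, with $|\phi'|\le B$ and $\phi'$ $B$-Lipschitz for some $B>0$, and let $D\in\mathbb R$. There are constants $C,C'>0$, depending only on $\phi$ and $D$, such that the following holds for all dimensions $m,n,k,d$. Let $A:\mathbb R^n\to\mathbb R^m$ be linear and non-zero, with spectral norm $\|A\|$ and smallest non-zero singular value $\sigma_A$; let $\bar x\in\mathbb R^n$, $\varepsilon\in\mathbb R^m$ and $y=A\bar x+\varepsilon$. Let $\ell\in C^1(\mathbb R^m)$ be a loss with $\min\ell=0=\ell(y)$ whose gradient is Lipschitz on bounded sets, and suppose that $\ell$ satisfies the Kurdyka–Łojasiewicz inequality with desingularizing function $\psi$: for some $r_0>0$, $\psi\in C^0([0,r_0))\cap C^1((0,r_0))$ is strictly increasing, $\psi(0)=0$, and $\psi'(\ell(z))\,\|\nabla\ell(z)\|\ge 1$ whenever $0<\ell(z)<r_0$. Put $$\rho=C\|A\|\sqrt{n\log d}+\sqrt m\,(\|A\bar x\|_\infty+\|\varepsilon\|_\infty),\qquad L_{\ell,0}=\sup_{\|v\|\le\rho,\ v\ne y}\frac{\|\nabla\ell(v)\|}{\|v-y\|},\qquad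 a=\frac{L_{\ell,0}}2\,\rho^2,$$ and suppose that $a<r_0$, so that $\psi(a)$ is defined. Consider the network $g(u,\theta)=\frac1{\sqrt k}V\phi(Wu)$ with $\theta=(V,W)\in\mathbb R^{n\times k}\times\mathbb R^{k\times d}$ (Euclidean norm) and Jacobian $J_g(\theta)$ of $g(u,\cdot)$. Let $u$ be uniform on $\mathbb S^{d-1}$, let $W_0$ have iid $\mathcal N(0,1)$ entries and be independent of $u$, and let $V_0$ be independent of $(W_0,u)$ with iid columns of identity covariance and centered entries bounded by $D$ in absolute value. Put $\theta_0=(V_0,W_0)$, $y_0=Ag(u,\theta_0)$, and let $\sigma_{\min}(J_g(\theta_0))$ be the $n$-th (smallest) singular value of $J_g(\theta_0)$. For $L>0$ and a step size $\gamma\in(0,1/L]$ let $$R'=\frac{2\nu_1\,\psi(\ell(y_0))}{\sigma_A\,\sigma_{\min}(J_g(\theta_0))},\quad \nu_1=\frac{1+\gamma L}{1-\gamma L/2},\qquad R=\sup\Bigl\{r\ge0:\ 2r\,\mathrm{Lip}_{\mathbb B(\theta_0,r)}(J_g)\le\sigma_{\min}(J_g(\theta_0))\Bigr\}\in[0,\infty],$$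 where $\mathrm{Lip}_{\mathbb B(\theta_0,r)}(J_g)$ is the Lipschitz constant on the ball in spectral norm; $R$ is the solution of $R=\sigma_{\min}(J_g(\theta_0))/(2\,\mathrm{Lip}_{\mathbb B(\theta_0,R)}(J_g))$ whenever $\sigma_{\min}(J_g(\theta_0))>0$ and there is a solution $R>0$. If $$k\ \ge\ C'\,\sigma_A^{-4}\,n\,\psi\Bigl(\frac{L_{\ell,0}}2\bigl(C\|A\|\sqrt{n\log d}+\sqrt m(\|A\bar x\|_\infty+\|\varepsilon\|_\infty)\bigr)^2\Bigr)^4,$$ and if moreover $y$ is the only minimizer of $\ell$ or $k\ge C'n$, then with probability at least $1-2n^{-1}-d^{-1}$ one has $\sigma_{\min}(J_g(\theta_0))>0$, $\ell(y_0)<r_0$ (so that $R'$ is defined), and $R'<R$ for all $L>0$ and $\gamma\in(0,1/L]$. -/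

import Mathlib

open MeasureTheory ProbabilityTheory Set Metric
open scoped NNReal ENNReal

noncomputable section

namespace DIP

/-- `ℝᵃ` with the Euclidean norm. -/
abbrev Vec (a : ℕ) : Type := EuclideanSpace ℝ (Fin a)

/-- The parameter space `ℝᵖ`, `p = n k + k d`, of a two-layer network, with the Euclidean norm:
the entries of `V ∈ ℝ^{n × k}` followed by those of `W ∈ ℝ^{k × d}`. -/
abbrev Param (n k d : ℕ) : Type := EuclideanSpace ℝ ((Fin n × Fin k) ⊕ (Fin k × Fin d))

/-- The parameter vector that gathers the entries of `V` and `W`. -/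
def toParam {n k d : ℕ} (V : Fin n → Fin k → ℝ) (W : Fin k → Fin d → ℝ) : Param n k d :=
  WithLp.toLp 2 (Sum.elim (fun p => V p.1 p.2) (fun p => W p.1 p.2))

def outerWeights {n k d : ℕ} (θ : Param n k d) : Matrix (Fin n) (Fin k) ℝ :=
  Matrix.of fun i j => θ (Sum.inl (i, j))

def innerWeights {n k d : ℕ} (θ : Param n k d) : Matrix (Fin k) (Fin d) ℝ :=
  Matrix.of fun j l => θ (Sum.inr (j, l))

/-- The two-layer network `g(u, θ) = (1/√k) V φ(W u)`, `θ = (V, W)`, with `φ` acting entrywise. -/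
def net {n k d : ℕ} (φ : ℝ → ℝ) (u : Vec d) (θ : Param n k d) : Vec n :=
  WithLp.toLp 2 ((1 / √(k : ℝ)) •
    (outerWeights θ).mulVec (fun j => φ ((innerWeights θ).mulVec u.ofLp j)))

/-- The Jacobian of `g(u, ·)` at `θ`. -/
def jac {n k d : ℕ} (φ : ℝ → ℝ) (u : Vec d) (θ : Param n k d) : Param n k d →L[ℝ] Vec n :=
  fderiv ℝ (net φ u) θ

/-- The smallest non-zero singular value (`0` for the zero operator): Mathlib lists the singular
values in decreasing order, and exactly the first `rank T` of them are non-zero. -/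
def sigmaMin {E F : Type*} [NormedAddCommGroup E] [InnerProductSpace ℝ E] [FiniteDimensional ℝ E]
    [NormedAddCommGroup F] [InnerProductSpace ℝ F] [FiniteDimensional ℝ F] (T : E →L[ℝ] F) : ℝ :=
  (T : E →ₗ[ℝ] F).singularValues (Module.finrank ℝ (LinearMap.range (T : E →ₗ[ℝ] F)) - 1)

/-- The best Lipschitz constant of `f` on `s`, in `[0, ∞]`. -/
def lipConst {X Y : Type*} [PseudoEMetricSpace X] [PseudoEMetricSpace Y] (f : X → Y) (s : Set X) :
    ℝ≥0∞ :=
  ⨅ (K : ℝ≥0) (_ : LipschitzOnWith K f s), (K : ℝ≥0∞)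

/-- The radius `R ∈ [0, ∞]` of the equation `R = σ / (2 Lip_{B(z, R)}(J))`, as the largest `r` with
`2 r Lip_{B(z, r)}(J) ≤ σ`. The Lipschitz constant may jump as `r` grows, so that the equation may
have no solution; if it has one, it is this number (`radius_eq_of_fixedPoint`). -/
def radius {X Y : Type*} [PseudoMetricSpace X] [PseudoEMetricSpace Y] (J : X → Y) (z : X) (σ : ℝ) :
    ℝ≥0∞ :=
  ⨆ (r : ℝ≥0) (_ : 2 * (r : ℝ≥0∞) * lipConst J (closedBall z r) ≤ ENNReal.ofReal σ), (r : ℝ≥0∞)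

theorem lipConst_mono {X Y : Type*} [PseudoEMetricSpace X] [PseudoEMetricSpace Y] (f : X → Y)
    {s t : Set X} (h : s ⊆ t) : lipConst f s ≤ lipConst f t :=
  le_iInf₂ fun K hK => iInf₂_le K (hK.mono h)

theorem radius_eq_of_fixedPoint {X Y : Type*} [PseudoMetricSpace X] [PseudoEMetricSpace Y]
    (J : X → Y) (z : X) (σ : ℝ) (hσ : 0 < σ) (R : ℝ≥0)
    (hR : (R : ℝ≥0∞) = ENNReal.ofReal σ / (2 * lipConst J (closedBall z R))) (hR0 : R ≠ 0) :
    radius J z σ = R := by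
  set Λ := lipConst J (closedBall z R) with hΛ
  have hσ0 : ENNReal.ofReal σ ≠ 0 := by simpa using hσ
  have h0 : 2 * Λ ≠ 0 := by
    intro h
    rw [h, ENNReal.div_zero hσ0] at hR
    exact ENNReal.coe_ne_top hR
  have ht : 2 * Λ ≠ ∞ := by
    intro h
    rw [h, ENNReal.div_top] at hR
    exact hR0 (by simpa using hR)
  have key : (R : ℝ≥0∞) * (2 * Λ) = ENNReal.ofReal σ := by
    rw [hR]; exact ENNReal.div_mul_cancel h0 ht
  apply le_antisymm
  · refine iSup₂_le fun r hr => ?_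
    by_contra hlt
    push Not at hlt
    have hmono : Λ ≤ lipConst J (closedBall z r) :=
      lipConst_mono J (closedBall_subset_closedBall (by exact_mod_cast hlt.le))
    have h1 : (r : ℝ≥0∞) * (2 * Λ) ≤ (R : ℝ≥0∞) * (2 * Λ) := by
      calc (r : ℝ≥0∞) * (2 * Λ) = 2 * (r : ℝ≥0∞) * Λ := by ring
        _ ≤ 2 * (r : ℝ≥0∞) * lipConst J (closedBall z r) := by gcongr
        _ ≤ _ := by rw [key]; exact hr
    exact absurd ((ENNReal.mul_le_mul_iff_left h0 ht).1 h1) (not_le.2 hlt)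
  · exact le_iSup₂_of_le R (by rw [← key, ← hΛ]; apply le_of_eq; ring) le_rfl

/-- `f : ℝᵐ → ℝ` is `C¹`, `min f = 0`, and `f` satisfies the Kurdyka–Łojasiewicz inequality on
`[0 < f < r₀]` with the desingularizing function `ψ` (only its values on `[0, r₀)` matter). -/
structure IsKL {m : ℕ} (ψ : ℝ → ℝ) (r₀ : ℝ) (f : Vec m → ℝ) : Prop where
  contDiff : ContDiff ℝ 1 f
  min_eq : IsLeast (range f) 0
  r₀_pos : 0 < r₀
  psi_continuousOn : ContinuousOn ψ (Ico 0 r₀)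
  psi_contDiffOn : ContDiffOn ℝ 1 ψ (Ioo 0 r₀)
  psi_strictMonoOn : StrictMonoOn ψ (Ico 0 r₀)
  psi_zero : ψ 0 = 0
  ineq : ∀ z, 0 < f z → f z < r₀ → 1 ≤ deriv ψ (f z) * ‖gradient f z‖

/-- `φ` is `C¹`, `φ'` is bounded by `B` and `B`-Lipschitz for some `B > 0`. -/
def IsActivation (φ : ℝ → ℝ) : Prop :=
  ContDiff ℝ 1 φ ∧
    ∃ B : ℝ≥0, 0 < B ∧ (∀ x, |deriv φ x| ≤ B) ∧ LipschitzWith B (deriv φ)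

/-- The uniform probability measure on the unit sphere of `ℝᵈ`, as a measure on `ℝᵈ`. -/
def uniformSphere (d : ℕ) : Measure (Vec d) :=
  (((volume : Measure (Vec d)).toSphere univ)⁻¹ • (volume : Measure (Vec d)).toSphere).map
    Subtype.val

/-- The random initialization: `u` is uniform on the sphere, `W` has iid standard Gaussian entries
and is independent of `u`, and `V` is independent of `(W, u)` and has iid columns with identity
covariance and centered entries bounded by `D`. -/
structure IsInit {Ω : Type*} [MeasurableSpace Ω] {n k d : ℕ} (P : Measure Ω) (D : ℝ)
    (u : Ω → Vec d) (W : Ω → Fin k → Fin d → ℝ) (V : Ω → Fin n → Fin k → ℝ) : Prop where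
  u_law : HasLaw u (uniformSphere d) P
  W_law : ∀ j l, HasLaw (fun ω => W ω j l) (gaussianReal 0 1) P
  W_indep : iIndepFun (fun (p : Fin k × Fin d) ω => W ω p.1 p.2) P
  W_indep_u : IndepFun W u P
  V_indep : IndepFun V (fun ω => (W ω, u ω)) P
  V_col_indep : iIndepFun (fun (j : Fin k) ω (i : Fin n) => V ω i j) P
  V_col_ident : ∀ j j', IdentDistrib (fun ω (i : Fin n) => V ω i j) (fun ω i => V ω i j') P P
  V_bdd : ∀ᵐ ω ∂P, ∀ i j, |V ω i j| ≤ D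
  V_centered : ∀ i j, ∫ ω, V ω i j ∂P = 0
  V_cov : ∀ j i i', cov[fun ω => V ω i j, fun ω => V ω i' j; P] = if i = i' then 1 else 0

/-- `‖v‖_∞`. -/
def supNorm {a : ℕ} (v : Vec a) : ℝ := ‖v.ofLp‖

/-- `ρ = C ‖A‖ √(n log d) + √m (‖A x‖_∞ + ‖ε‖_∞)`. -/
def initBound {m n : ℕ} (C : ℝ) (d : ℕ) (A : Vec n →L[ℝ] Vec m) (x : Vec n) (ε : Vec m) : ℝ :=
  C * ‖A‖ * √((n : ℝ) * Real.log d) + √(m : ℝ) * (supNorm (A x) + supNorm ε)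

/-- The supremum of `‖∇ℓ(v)‖ / ‖v - y‖` over `v ∈ B(0, ρ)`, `v ≠ y`. -/
def gradRatio {m : ℕ} (ℓ : Vec m → ℝ) (y : Vec m) (ρ : ℝ) : ℝ :=
  sSup ((fun v => ‖gradient ℓ v‖ / ‖v - y‖) '' (closedBall 0 ρ \ {y}))

/-- `(L_{ℓ,0} / 2) ρ²` with `ρ = initBound C d A x ε` and `y = A x + ε`. -/
def initLossBound {m n : ℕ} (C : ℝ) (d : ℕ) (A : Vec n →L[ℝ] Vec m) (x : Vec n) (ε : Vec m)
    (ℓ : Vec m → ℝ) : ℝ :=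
  gradRatio ℓ (A x + ε) (initBound C d A x ε) / 2 * initBound C d A x ε ^ 2

/-- `ν₁ = (1 + γ L) / (1 - γ L / 2)`. -/
def nuOne (γ L : ℝ) : ℝ := (1 + γ * L) / (1 - γ * L / 2)

/-- `R' = 2 ν₁ ψ(ℓ(y₀)) / (σ_A σ_min(J₀))`, where `y₀ = A g(u, θ₀)` and `J₀ = J_g(θ₀)`. -/
def radius' {m n k d : ℕ} (φ ψ : ℝ → ℝ) (ℓ : Vec m → ℝ) (A : Vec n →L[ℝ] Vec m) (u : Vec d)
    (θ₀ : Param n k d) (γ L : ℝ) : ℝ :=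
  2 * nuOne γ L * ψ (ℓ (A (net φ u θ₀))) / (sigmaMin A * sigmaMin (jac φ u θ₀))

/-- The initialization condition `σ_min(J₀) > 0` and `R' < R`, for every `L > 0` and every step
size `γ ∈ (0, 1/L]`. Here `σ_min(J₀) > 0` includes that `J₀` has full row rank `n` (that some
singular value is non-zero would say nothing), and `ψ` is evaluated inside its domain. -/
structure InitCondition {m n k d : ℕ} (φ ψ : ℝ → ℝ) (r₀ : ℝ) (ℓ : Vec m → ℝ)
    (A : Vec n →L[ℝ] Vec m) (u : Vec d) (θ₀ : Param n k d) : Prop where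
  surjective : Function.Surjective (jac φ u θ₀)
  sigmaMin_pos : 0 < sigmaMin (jac φ u θ₀)
  loss_lt : ℓ (A (net φ u θ₀)) < r₀
  radius_lt : ∀ L γ : ℝ, 0 < L → 0 < γ → γ ≤ 1 / L →
    ENNReal.ofReal (radius' φ ψ ℓ A u θ₀ γ L) <
      radius (jac φ u) θ₀ (sigmaMin (jac φ u θ₀))

end DIP

end

/-!
Put `c = 𝔼 φ(G)²` for a standard Gaussian `G`. As `‖u‖ = 1`, the preactivations `W u` are iid
standard Gaussian, so by Chebyshev's inequality `‖φ(W u)‖²` lies between `k c / 2` and `3 k c / 2`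
outside an event of probability of order `1 / k`. Conditionally on `(W, u)`, the output
`√k g(u, θ₀) = ∑ j, φ(W u)_j V_j` is a sum of independent centered bounded vectors. With
`cosh ‖·‖` as a dimension-free replacement of the exponential, its norm has subgaussian tails, so
`‖g(u, θ₀)‖ ≤ C √(n log d)` up to probability `1 / d`.

On the intersection of these events, the derivatives of `g` in the direction of rank-one
perturbations of `V` already give `σ_min(J₀) ≥ ‖φ(W u)‖ / √k ≥ √(c / 2)`. The Jacobian is Lipschitz
with constant of order `(√n + r) / √k` on the ball of radius `r`, which makes `R` large as soon as
`k` is of order `n max(1, q)⁴`, where `q = ψ(a) / σ_A`. On the other hand `ℓ(y₀) ≤ a`, since `ℓ`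
grows at most quadratically from its minimizer, so `R'` is at most of order `q`.

The bound on `k` only involves `q⁴`. If `y` is the only minimizer, then the Kurdyka–Łojasiewicz
inequality bounds the distance to `y` by `ψ ∘ ℓ`; at distance `ρ ≥ ‖A‖` this gives `σ_A ≤ ψ(a)`,
that is `q ≥ 1`, so that the bound on `k` dominates the order of `n` by itself.
-/

namespace DIP

section SingularValues

variable {E F : Type*} [NormedAddCommGroup E] [InnerProductSpace ℝ E] [FiniteDimensional ℝ E]
  [NormedAddCommGroup F] [InnerProductSpace ℝ F]

theorem finrank_range_pos_of_ne_zero {T : E →L[ℝ] F} (hT : T ≠ 0) :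
    0 < Module.finrank ℝ (LinearMap.range (T : E →ₗ[ℝ] F)) := by
  rw [Nat.pos_iff_ne_zero, Ne, Submodule.finrank_eq_zero, LinearMap.range_eq_bot]
  exact fun h => hT (ContinuousLinearMap.coe_injective h)

variable [FiniteDimensional ℝ F]

theorem sigmaMin_pos_of_ne_zero {T : E →L[ℝ] F} (hT : T ≠ 0) : 0 < sigmaMin T :=
  (LinearMap.singularValues_pos_iff_lt_finrank_range _).2
    (Nat.sub_lt (finrank_range_pos_of_ne_zero hT) one_pos)

theorem exists_adjoint_apply_eq_sigmaMin_sq_smul {T : E →L[ℝ] F} (hT : T ≠ 0) :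
    ∃ x : E, x ≠ 0 ∧ LinearMap.adjoint (T : E →ₗ[ℝ] F) (T x) = sigmaMin T ^ 2 • x := by
  have hpos := finrank_range_pos_of_ne_zero hT
  have hle := LinearMap.finrank_range_le (T : E →ₗ[ℝ] F)
  obtain ⟨x, hx⟩ := (LinearMap.hasEigenvalue_adjoint_comp_self_sq_singularValues
    (T : E →ₗ[ℝ] F) (n := Module.finrank ℝ (LinearMap.range (T : E →ₗ[ℝ] F)) - 1)
    (by omega)).exists_hasEigenvector
  exact ⟨x, hx.2, hx.apply_eq_smul⟩

theorem norm_apply_of_adjoint_apply_eq {T : E →L[ℝ] F} {x : E} {s : ℝ} (hs : 0 ≤ s)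
    (hx : LinearMap.adjoint (T : E →ₗ[ℝ] F) (T x) = s ^ 2 • x) : ‖T x‖ = s * ‖x‖ := by
  have hinner := LinearMap.adjoint_inner_left (T : E →ₗ[ℝ] F) x (T x)
  rw [hx, real_inner_smul_left, real_inner_self_eq_norm_sq, ContinuousLinearMap.coe_coe,
    real_inner_self_eq_norm_sq, ← mul_pow] at hinner
  exact ((sq_eq_sq₀ (by positivity) (norm_nonneg _)).1 hinner).symm

theorem sigmaMin_le_norm {T : E →L[ℝ] F} (hT : T ≠ 0) : sigmaMin T ≤ ‖T‖ := by
  obtain ⟨x, hx0, hx⟩ := exists_adjoint_apply_eq_sigmaMin_sq_smul hT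
  refine le_of_mul_le_mul_right ?_ (norm_pos_iff.2 hx0)
  rw [← norm_apply_of_adjoint_apply_eq (sigmaMin_pos_of_ne_zero hT).le hx]
  exact T.le_opNorm x

theorem le_sigmaMin_of_rightInverse [Nontrivial F] {T : E →L[ℝ] F} {s : ℝ}
    (hT : ∀ w, ∃ v, T v = w ∧ s * ‖v‖ ≤ ‖w‖) : s ≤ sigmaMin T := by
  have hT0 : T ≠ 0 := by
    rintro rfl
    obtain ⟨w, hw⟩ := exists_ne (0 : F)
    obtain ⟨v, hv, -⟩ := hT w
    exact hw hv.symm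
  have hσ := sigmaMin_pos_of_ne_zero hT0
  rcases le_or_gt s 0 with hs | hs
  · exact hs.trans hσ.le
  obtain ⟨x, hx0, hx⟩ := exists_adjoint_apply_eq_sigmaMin_sq_smul hT0
  have hTx := norm_apply_of_adjoint_apply_eq hσ.le hx
  obtain ⟨v, hv, hle⟩ := hT (T x)
  -- `x` is orthogonal to the kernel of `T`, so it is the shortest preimage of `T x`.
  have hinner : inner ℝ x v = ‖x‖ ^ 2 := by
    have := LinearMap.adjoint_inner_left (T : E →ₗ[ℝ] F) v (T x)
    rw [hx, ContinuousLinearMap.coe_coe, hv, real_inner_smul_left, real_inner_self_eq_norm_sq,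
      hTx, mul_pow] at this
    exact mul_left_cancel₀ (pow_ne_zero 2 hσ.ne') this
  have hxpos : 0 < ‖x‖ := norm_pos_iff.2 hx0
  have hxv : ‖x‖ ≤ ‖v‖ := by
    refine le_of_mul_le_mul_left ?_ hxpos
    rw [← sq, ← hinner]
    exact real_inner_le_norm x v
  refine le_of_mul_le_mul_right ?_ hxpos
  calc s * ‖x‖ ≤ s * ‖v‖ := by gcongr
    _ ≤ ‖T x‖ := hle
    _ = sigmaMin T * ‖x‖ := hTx

end SingularValues

section Network

variable {n k d : ℕ}

/-- The pre-activation `W u`, as a linear function of the parameter `θ = (V, W)`. -/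
noncomputable def preact (u : Vec d) : Param n k d →L[ℝ] Vec k :=
  LinearMap.toContinuousLinearMap
    { toFun := fun θ => WithLp.toLp 2 ((innerWeights θ).mulVec u.ofLp)
      map_add' := fun θ θ' => congrArg (WithLp.toLp 2)
        (Matrix.add_mulVec (innerWeights θ) (innerWeights θ') u.ofLp)
      map_smul' := fun c θ => congrArg (WithLp.toLp 2)
        (Matrix.smul_mulVec c (innerWeights θ) u.ofLp) }

/-- The outer layer `V z`, as a bilinear function of `θ = (V, W)` and `z`. -/
noncomputable def outer : Param n k d →L[ℝ] Vec k →L[ℝ] Vec n :=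
  (LinearMap.mk₂ ℝ (fun (θ : Param n k d) (z : Vec k) =>
      (WithLp.toLp 2 ((outerWeights θ).mulVec z.ofLp) : Vec n))
    (fun θ θ' z => congrArg (WithLp.toLp 2)
      (Matrix.add_mulVec (outerWeights θ) (outerWeights θ') z.ofLp))
    (fun c θ z => congrArg (WithLp.toLp 2) (Matrix.smul_mulVec c (outerWeights θ) z.ofLp))
    (fun θ z z' => congrArg (WithLp.toLp 2) (Matrix.mulVec_add (outerWeights θ) z.ofLp z'.ofLp))
    (fun c θ z => congrArg (WithLp.toLp 2)
      (Matrix.mulVec_smul (outerWeights θ) c z.ofLp))).toContinuousBilinearMap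

/-- The hidden layer `f(W u)`, with `f` acting entrywise. -/
noncomputable def hidden (f : ℝ → ℝ) (u : Vec d) (θ : Param n k d) : Vec k :=
  WithLp.toLp 2 fun j => f (preact u θ j)

/-- The entrywise product of two vectors. -/
noncomputable def hadamard : Vec k →L[ℝ] Vec k →L[ℝ] Vec k :=
  (LinearMap.mk₂ ℝ (fun x y : Vec k => (WithLp.toLp 2 (x.ofLp * y.ofLp) : Vec k))
    (fun x x' y => congrArg (WithLp.toLp 2) (add_mul x.ofLp x'.ofLp y.ofLp))
    (fun c x y => congrArg (WithLp.toLp 2) (smul_mul_assoc c x.ofLp y.ofLp))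
    (fun x y y' => congrArg (WithLp.toLp 2) (mul_add x.ofLp y.ofLp y'.ofLp))
    (fun c x y => congrArg (WithLp.toLp 2)
      (mul_smul_comm c x.ofLp y.ofLp))).toContinuousBilinearMap

/-- The `j`-th column of `V`, the outgoing weights of the `j`-th neuron. -/
noncomputable def column (θ : Param n k d) (j : Fin k) : Vec n :=
  outer θ (EuclideanSpace.single j 1)

theorem outer_apply (θ : Param n k d) (z : Vec k) (i : Fin n) :
    outer θ z i = ∑ j, θ (Sum.inl (i, j)) * z j := rfl

theorem column_apply (θ : Param n k d) (j : Fin k) (i : Fin n) :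
    column θ j i = θ (Sum.inl (i, j)) := by
  simp [column, outer_apply]

theorem net_eq_smul_outer (φ : ℝ → ℝ) (u : Vec d) (θ : Param n k d) :
    net φ u θ = (1 / √(k : ℝ)) • outer θ (hidden φ u θ) := rfl

theorem hasFDerivAt_hidden {φ : ℝ → ℝ} (hφ : Differentiable ℝ φ) (u : Vec d) (θ : Param n k d) :
    HasFDerivAt (hidden φ u) (hadamard (hidden (deriv φ) u θ) ∘L preact u) θ := by
  rw [← hasFDerivWithinAt_univ, hasFDerivWithinAt_euclidean]
  refine fun j => HasFDerivAt.hasFDerivWithinAt ?_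
  exact (hφ _).hasDerivAt.comp_hasFDerivAt θ
    ((PiLp.proj 2 (fun _ => ℝ) j ∘L preact u).hasFDerivAt (x := θ))

theorem jac_apply {φ : ℝ → ℝ} (hφ : Differentiable ℝ φ) (u : Vec d) (θ h : Param n k d) :
    jac φ u θ h = (1 / √(k : ℝ)) • (outer h (hidden φ u θ) +
      outer θ (hadamard (hidden (deriv φ) u θ) (preact u h))) := by
  have hnet : HasFDerivAt (net φ u) _ θ :=
    ((outer.hasFDerivAt (x := θ)).clm_apply (hasFDerivAt_hidden hφ u θ)).const_smul
      (1 / √(k : ℝ))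
  rw [jac, hnet.fderiv, add_comm (outer h _)]
  rfl

theorem norm_toLp_mulVec_le {ι κ : Type*} [Fintype ι] [Fintype κ] (M : Matrix ι κ ℝ)
    (z : EuclideanSpace ℝ κ) :
    ‖(WithLp.toLp 2 (M.mulVec z.ofLp) : EuclideanSpace ℝ ι)‖ ≤
      √(∑ i, ∑ j, M i j ^ 2) * ‖z‖ := by
  rw [EuclideanSpace.norm_eq z, ← Real.sqrt_mul (by positivity), EuclideanSpace.norm_eq,
    Finset.sum_mul]
  simp only [Real.norm_eq_abs, sq_abs]
  gcongr with i
  exact Finset.sum_mul_sq_le_sq_mul_sq _ _ _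

theorem norm_preact_le (u : Vec d) (θ : Param n k d) : ‖preact u θ‖ ≤ ‖θ‖ * ‖u‖ := by
  refine (norm_toLp_mulVec_le (innerWeights θ) u).trans ?_
  gcongr
  refine Real.sqrt_le_iff.2 ⟨norm_nonneg _, ?_⟩
  rw [EuclideanSpace.real_norm_sq_eq, Fintype.sum_sum_type, Fintype.sum_prod_type,
    Fintype.sum_prod_type]
  exact le_add_of_nonneg_left (by positivity)

theorem norm_outer_apply_le (θ : Param n k d) (z : Vec k) : ‖outer θ z‖ ≤ ‖θ‖ * ‖z‖ := by
  refine (norm_toLp_mulVec_le (outerWeights θ) z).trans ?_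
  gcongr
  refine Real.sqrt_le_iff.2 ⟨norm_nonneg _, ?_⟩
  rw [EuclideanSpace.real_norm_sq_eq, Fintype.sum_sum_type, Fintype.sum_prod_type]
  exact le_add_of_nonneg_right (by positivity)

theorem norm_column_le (θ : Param n k d) (j : Fin k) : ‖column θ j‖ ≤ ‖θ‖ := by
  simpa [column] using norm_outer_apply_le θ (EuclideanSpace.single j 1)

theorem norm_hidden_sub_le {f : ℝ → ℝ} {B : ℝ≥0} (hf : LipschitzWith B f) (u : Vec d)
    (θ θ' : Param n k d) : ‖hidden f u θ - hidden f u θ'‖ ≤ B * (‖θ - θ'‖ * ‖u‖) := by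
  refine le_trans ?_ (mul_le_mul_of_nonneg_left (norm_preact_le u (θ - θ')) B.coe_nonneg)
  rw [← abs_of_nonneg B.coe_nonneg, ← Real.norm_eq_abs, ← norm_smul, map_sub,
    EuclideanSpace.norm_eq, EuclideanSpace.norm_eq]
  gcongr with j
  simpa [hidden, norm_smul, Real.dist_eq] using hf.dist_le_mul (preact u θ j) (preact u θ' j)

theorem norm_hadamard_le {x : Vec k} {b : ℝ} (hx : ∀ j, |x j| ≤ b) (y : Vec k) :
    ‖hadamard x y‖ ≤ |b| * ‖y‖ := by
  rw [← Real.norm_eq_abs, ← norm_smul, EuclideanSpace.norm_eq, EuclideanSpace.norm_eq]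
  gcongr with j
  rw [PiLp.smul_apply, norm_smul]
  exact (norm_mul_le (x j) (y j)).trans
    (mul_le_mul_of_nonneg_right ((hx j).trans (le_abs_self b)) (norm_nonneg _))

theorem outer_eq_sum_smul_column (θ : Param n k d) (z : Vec k) :
    outer θ z = ∑ j, z j • column θ j := by
  ext i
  simp [outer_apply, column_apply, mul_comm]

theorem norm_outer_hadamard_le {θ : Param n k d} {K : ℝ} (hK : 0 ≤ K)
    (hθ : ∀ j, ‖column θ j‖ ≤ K) (x y : Vec k) :
    ‖outer θ (hadamard x y)‖ ≤ K * (‖x‖ * ‖y‖) := by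
  calc ‖outer θ (hadamard x y)‖ ≤ ∑ j, ‖x j‖ * ‖y j‖ * ‖column θ j‖ := by
        rw [outer_eq_sum_smul_column]
        refine (norm_sum_le _ _).trans_eq (Finset.sum_congr rfl fun j _ => ?_)
        rw [norm_smul, ← norm_mul]
        rfl
    _ ≤ ∑ j, ‖x j‖ * ‖y j‖ * K := by
        gcongr with j
        exact hθ j
    _ = K * ∑ j, ‖x j‖ * ‖y j‖ := by rw [← Finset.sum_mul, mul_comm]
    _ ≤ K * (‖x‖ * ‖y‖) := by
        rw [EuclideanSpace.norm_eq x, EuclideanSpace.norm_eq y]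
        gcongr
        exact Real.sum_mul_le_sqrt_mul_sqrt _ _ _

section Jacobian

variable {φ : ℝ → ℝ} {B : ℝ≥0}

theorem jac_sub_apply (hφ : Differentiable ℝ φ) (u : Vec d) (θ θ' h : Param n k d) :
    (jac φ u θ - jac φ u θ') h = (1 / √(k : ℝ)) •
      (outer h (hidden φ u θ - hidden φ u θ') +
        outer (θ - θ') (hadamard (hidden (deriv φ) u θ') (preact u h)) +
        outer θ (hadamard (hidden (deriv φ) u θ - hidden (deriv φ) u θ') (preact u h))) := by
  simp only [sub_apply, jac_apply hφ, map_sub, ← smul_sub]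
  congr 1
  abel

theorem norm_jac_sub_le (hφ : Differentiable ℝ φ) (hB : ∀ x, |deriv φ x| ≤ B)
    (hL : LipschitzWith B (deriv φ)) (u : Vec d) {K : ℝ} (hK : 0 ≤ K) {θ : Param n k d}
    (hθ : ∀ j, ‖column θ j‖ ≤ K) (θ' : Param n k d) :
    ‖jac φ u θ - jac φ u θ'‖ ≤ B / √(k : ℝ) * (‖u‖ * (2 + K * ‖u‖)) * ‖θ - θ'‖ := by
  refine ContinuousLinearMap.opNorm_le_bound _ (by positivity) fun h => ?_
  have hφL : LipschitzWith B φ := lipschitzWith_of_nnnorm_deriv_le hφ hB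
  have hidden_term : ‖outer h (hidden φ u θ - hidden φ u θ')‖ ≤
      ‖h‖ * (B * (‖θ - θ'‖ * ‖u‖)) :=
    (norm_outer_apply_le _ _).trans (by gcongr; exact norm_hidden_sub_le hφL u θ θ')
  have outer_term : ‖outer (θ - θ') (hadamard (hidden (deriv φ) u θ') (preact u h))‖ ≤
      ‖θ - θ'‖ * (B * (‖h‖ * ‖u‖)) := by
    refine (norm_outer_apply_le _ _).trans ?_
    gcongr
    refine (norm_hadamard_le (fun j => hB _) _).trans ?_
    rw [abs_of_nonneg B.coe_nonneg]
    gcongr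
    exact norm_preact_le u h
  have deriv_term : ‖outer θ (hadamard (hidden (deriv φ) u θ - hidden (deriv φ) u θ')
      (preact u h))‖ ≤ K * (B * (‖θ - θ'‖ * ‖u‖) * (‖h‖ * ‖u‖)) := by
    refine (norm_outer_hadamard_le hK hθ _ _).trans ?_
    gcongr
    exacts [norm_hidden_sub_le hL u θ θ', norm_preact_le u h]
  calc ‖(jac φ u θ - jac φ u θ') h‖
      ≤ 1 / √(k : ℝ) * (‖h‖ * (B * (‖θ - θ'‖ * ‖u‖)) + ‖θ - θ'‖ * (B * (‖h‖ * ‖u‖)) +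
          K * (B * (‖θ - θ'‖ * ‖u‖) * (‖h‖ * ‖u‖))) := by
        rw [jac_sub_apply hφ, norm_smul, Real.norm_of_nonneg (by positivity)]
        gcongr
        exact norm_add₃_le.trans (by gcongr)
    _ = B / √(k : ℝ) * (‖u‖ * (2 + K * ‖u‖)) * ‖θ - θ'‖ * ‖h‖ := by ring

theorem lipConst_jac_le (hφ : Differentiable ℝ φ) (hB : ∀ x, |deriv φ x| ≤ B)
    (hL : LipschitzWith B (deriv φ)) (u : Vec d) {K : ℝ} (hK : 0 ≤ K) {θ₀ : Param n k d}
    (hθ₀ : ∀ j, ‖column θ₀ j‖ ≤ K) {r : ℝ} (hr : 0 ≤ r) :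
    lipConst (jac φ u) (closedBall θ₀ r) ≤
      ENNReal.ofReal (B / √(k : ℝ) * (‖u‖ * (2 + (K + r) * ‖u‖))) := by
  refine iInf₂_le (Real.toNNReal _) (LipschitzOnWith.of_dist_le_mul fun θ hθ θ' _ => ?_)
  have hcol : ∀ j, ‖column θ j‖ ≤ K + r := fun j => by
    have hsub : column θ j = column θ₀ j + column (θ - θ₀) j := by simp [column]
    rw [hsub]
    refine (norm_add_le _ _).trans (add_le_add (hθ₀ j) ((norm_column_le _ j).trans ?_))
    rwa [← dist_eq_norm]
  rw [dist_eq_norm, dist_eq_norm, Real.coe_toNNReal _ (by positivity)]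
  exact norm_jac_sub_le hφ hB hL u (by positivity) hcol θ'

theorem le_radius_jac (hφ : Differentiable ℝ φ) (hB : ∀ x, |deriv φ x| ≤ B)
    (hL : LipschitzWith B (deriv φ)) (u : Vec d) {K : ℝ} (hK : 0 ≤ K) {θ₀ : Param n k d}
    (hθ₀ : ∀ j, ‖column θ₀ j‖ ≤ K) {r σ : ℝ} (hr : 0 ≤ r)
    (hσ : 2 * r * (B / √(k : ℝ) * (‖u‖ * (2 + (K + r) * ‖u‖))) ≤ σ) :
    ENNReal.ofReal r ≤ radius (jac φ u) θ₀ σ := by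
  refine le_iSup₂_of_le r.toNNReal ?_ le_rfl
  rw [Real.coe_toNNReal r hr]
  calc 2 * ENNReal.ofReal r * lipConst (jac φ u) (closedBall θ₀ r)
      ≤ ENNReal.ofReal 2 * ENNReal.ofReal r *
          ENNReal.ofReal (B / √(k : ℝ) * (‖u‖ * (2 + (K + r) * ‖u‖))) := by
        rw [ENNReal.ofReal_ofNat]
        gcongr
        exact lipConst_jac_le hφ hB hL u hK hθ₀ hr
    _ = ENNReal.ofReal (2 * r * (B / √(k : ℝ) * (‖u‖ * (2 + (K + r) * ‖u‖)))) := by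
        rw [← ENNReal.ofReal_mul zero_le_two, ← ENNReal.ofReal_mul (by positivity)]
    _ ≤ ENNReal.ofReal σ := ENNReal.ofReal_le_ofReal hσ

/-- The parameter with outer weights `w zᵀ` and inner weights `0`: a direction that moves only the
outer layer, along which the Jacobian can be inverted explicitly. -/
noncomputable def rankOne (w : Vec n) (z : Vec k) : Param n k d :=
  toParam (fun i j => w i * z j) 0

theorem norm_rankOne (w : Vec n) (z : Vec k) :
    ‖(rankOne w z : Param n k d)‖ = ‖w‖ * ‖z‖ := by
  rw [EuclideanSpace.norm_eq w, EuclideanSpace.norm_eq z, ← Real.sqrt_mul (by positivity),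
    EuclideanSpace.norm_eq, Fintype.sum_sum_type, Fintype.sum_prod_type, Finset.sum_mul_sum]
  simp [rankOne, toParam, mul_pow]

theorem jac_rankOne (hφ : Differentiable ℝ φ) (u : Vec d) (θ : Param n k d) (w : Vec n)
    (z : Vec k) :
    jac φ u θ (rankOne w z) = (1 / √(k : ℝ) * inner ℝ (hidden φ u θ) z) • w := by
  have hpre : preact u (rankOne w z : Param n k d) = 0 := by
    ext j
    simp [preact, rankOne, toParam, innerWeights, Matrix.mulVec, dotProduct]
  have houter : outer (rankOne w z : Param n k d) (hidden φ u θ) =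
      inner ℝ (hidden φ u θ) z • w := by
    ext i
    simp only [outer_apply, rankOne, toParam, Sum.elim_inl, PiLp.inner_apply, PiLp.smul_apply,
      RCLike.inner_apply, conj_trivial, smul_eq_mul, Finset.sum_mul]
    exact Finset.sum_congr rfl fun j _ => by ring
  rw [jac_apply hφ, hpre, houter, map_zero, map_zero, add_zero, smul_smul]

theorem exists_jac_eq (hφ : Differentiable ℝ φ) (u : Vec d) {θ : Param n k d}
    (hθ : 0 < ‖hidden φ u θ‖) (hk : 0 < k) (w : Vec n) :
    ∃ h, jac φ u θ h = w ∧ ‖hidden φ u θ‖ / √(k : ℝ) * ‖h‖ ≤ ‖w‖ := by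
  refine ⟨rankOne w ((√(k : ℝ) / ‖hidden φ u θ‖ ^ 2) • hidden φ u θ), ?_, le_of_eq ?_⟩
  · rw [jac_rankOne hφ, real_inner_smul_right, real_inner_self_eq_norm_sq]
    have : 1 / √(k : ℝ) * (√(k : ℝ) / ‖hidden φ u θ‖ ^ 2 * ‖hidden φ u θ‖ ^ 2) = 1 := by
      field_simp
    rw [this, one_smul]
  · rw [norm_rankOne, norm_smul, Real.norm_of_nonneg (by positivity)]
    field_simp

theorem norm_hidden_div_sqrt_le_sigmaMin_jac (hφ : Differentiable ℝ φ) (u : Vec d)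
    {θ : Param n k d} (hθ : 0 < ‖hidden φ u θ‖) (hk : 0 < k) (hn : 0 < n) :
    ‖hidden φ u θ‖ / √(k : ℝ) ≤ sigmaMin (jac φ u θ) :=
  have : NeZero n := ⟨hn.ne'⟩
  le_sigmaMin_of_rightInverse (exists_jac_eq hφ u hθ hk)

end Jacobian

end Network

section Slope

variable {E : Type*} [NormedAddCommGroup E] [NormedSpace ℝ E]

theorem exists_isLocalMin_add_mul_dist {X : Type*} [PseudoMetricSpace X] [ProperSpace X]
    {F : X → ℝ} {z : X} {c ρ : ℝ} (hF : ContinuousOn F (closedBall z ρ))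
    (hF0 : ∀ v ∈ closedBall z ρ, 0 ≤ F v) (hρ : 0 ≤ ρ) (hz : F z < c * ρ) :
    ∃ w ∈ ball z ρ, F w + c * dist w z ≤ F z ∧ IsLocalMin (fun v => F v + c * dist v w) w := by
  have hzmem : z ∈ closedBall z ρ := mem_closedBall_self hρ
  have hc : 0 < c := pos_of_mul_pos_left ((hF0 z hzmem).trans_lt hz) hρ
  obtain ⟨w, hw, hmin⟩ := (isCompact_closedBall z ρ).exists_isMinOn ⟨z, hzmem⟩
    (hF.add (by fun_prop : Continuous fun v => c * dist v z).continuousOn)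
  have hwz : F w + c * dist w z ≤ F z := by simpa using hmin hzmem
  have hwball : w ∈ ball z ρ :=
    lt_of_mul_lt_mul_left (by linarith [hF0 w hw]) hc.le
  refine ⟨w, hwball, hwz, ?_⟩
  filter_upwards [isOpen_ball.mem_nhds hwball] with v hv
  have hvw : F w + c * dist w z ≤ F v + c * dist v z := hmin (ball_subset_closedBall hv)
  have htri := mul_le_mul_of_nonneg_left (dist_triangle v w z) hc.le
  rw [dist_self, mul_zero, add_zero]
  linarith

theorem norm_le_of_isLocalMin_add_mul_dist {f : E → ℝ} {f' : E →L[ℝ] ℝ} {w : E} {c : ℝ}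
    (hc : 0 ≤ c) (hf : HasFDerivAt f f' w) (hmin : IsLocalMin (fun v => f v + c * dist v w) w) :
    ‖f'‖ ≤ c := by
  have hdir : ∀ h, 0 ≤ f' h + c * ‖h‖ := fun h => by
    have hline : HasDerivAt (fun t : ℝ => w + t • h) h 0 := by
      simpa using ((hasDerivAt_id (0 : ℝ)).smul_const h).const_add w
    have hder : HasDerivAt (fun t : ℝ => f (w + t • h) + c * (t * ‖h‖)) (f' h + c * ‖h‖) 0 := by
      refine HasDerivAt.add ?_ ?_
      · exact HasFDerivAt.comp_hasDerivAt (0 : ℝ) (by simpa using hf) hline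
      · simpa using ((hasDerivAt_id (0 : ℝ)).mul_const ‖h‖).const_mul c
    have hlocal : IsLocalMinOn (fun t : ℝ => f (w + t • h) + c * (t * ‖h‖)) (Ici 0) 0 := by
      have htendsto : Filter.Tendsto (fun t : ℝ => w + t • h) (nhdsWithin 0 (Ici 0)) (nhds w) :=
        (hline.continuousAt.tendsto.mono_left nhdsWithin_le_nhds).trans (by simp)
      filter_upwards [htendsto hmin, self_mem_nhdsWithin] with t ht (ht0 : 0 ≤ t)
      simpa [norm_smul, abs_of_nonneg ht0] using ht
    simpa using hlocal.hasFDerivWithinAt_nonneg hder.hasFDerivAt.hasFDerivWithinAt (y := 1)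
      (mem_posTangentConeAt_of_segment_subset (by simp [segment_eq_Icc, Icc_subset_Ici_self]))
  refine ContinuousLinearMap.opNorm_le_bound _ hc fun h => abs_le.2 ⟨?_, ?_⟩
  · linarith [hdir h]
  · have := hdir (-h)
    rw [map_neg, norm_neg] at this
    linarith

theorem le_add_half_mul_norm_sub_sq {f : E → ℝ} {s : Set E} {y v : E} {L : ℝ}
    (hs : StarConvex ℝ y s) (hv : v ∈ s) (hf : ∀ w ∈ s, DifferentiableAt ℝ f w)
    (hL : ∀ w ∈ s, ‖fderiv ℝ f w‖ ≤ L * ‖w - y‖) : f v ≤ f y + L / 2 * ‖v - y‖ ^ 2 := by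
  have hmem : ∀ t ∈ Icc (0 : ℝ) 1, y + t • (v - y) ∈ s := fun t ht =>
    hs.add_smul_sub_mem hv ht.1 ht.2
  have hleft : ∀ t ∈ Icc (0 : ℝ) 1, HasDerivAt (fun t : ℝ => f (y + t • (v - y)))
      (fderiv ℝ f (y + t • (v - y)) (v - y)) t := fun t ht =>
    (hf _ (hmem t ht)).hasFDerivAt.comp_hasDerivAt t
      (by simpa using ((hasDerivAt_id t).smul_const (v - y)).const_add y)
  have hright : ∀ t : ℝ, HasDerivAt (fun t : ℝ => f y + L / 2 * ‖v - y‖ ^ 2 * t ^ 2)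
      (L * ‖v - y‖ ^ 2 * t) t := fun t =>
    (((hasDerivAt_pow 2 t).const_mul (L / 2 * ‖v - y‖ ^ 2)).const_add (f y)).congr_deriv
      (by push_cast; ring)
  have hslope : ∀ t ∈ Ico (0 : ℝ) 1,
      fderiv ℝ f (y + t • (v - y)) (v - y) ≤ L * ‖v - y‖ ^ 2 * t := fun t ht => by
    calc fderiv ℝ f (y + t • (v - y)) (v - y)
        ≤ ‖fderiv ℝ f (y + t • (v - y))‖ * ‖v - y‖ :=
          (le_abs_self _).trans ((fderiv ℝ f _).le_opNorm _)
      _ ≤ L * ‖y + t • (v - y) - y‖ * ‖v - y‖ := by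
          gcongr
          exact hL _ (hmem t (Ico_subset_Icc_self ht))
      _ = L * ‖v - y‖ ^ 2 * t := by
          rw [add_sub_cancel_left, norm_smul, Real.norm_of_nonneg ht.1]
          ring
  have key := image_le_of_deriv_right_le_deriv_boundary
    (fun t ht => (hleft t ht).continuousAt.continuousWithinAt)
    (fun t ht => (hleft t (Ico_subset_Icc_self ht)).hasDerivWithinAt) (by simp)
    (fun t _ => (hright t).continuousAt.continuousWithinAt)
    (fun t _ => (hright t).hasDerivWithinAt) hslope (right_mem_Icc.2 zero_le_one)
  simpa using key

theorem exists_norm_le_and_norm_sub_eq [Nontrivial E] {y : E} {ρ : ℝ} (hy : ‖y‖ ≤ ρ) :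
    ∃ z : E, ‖z‖ ≤ ρ ∧ ‖z - y‖ = ρ := by
  have hρ : 0 ≤ ρ := (norm_nonneg y).trans hy
  rcases eq_or_ne y 0 with rfl | hy0
  · obtain ⟨z, hz⟩ := exists_norm_eq E hρ
    exact ⟨z, hz.le, by rw [sub_zero, hz]⟩
  have hnorm : 0 < ‖y‖ := norm_pos_iff.2 hy0
  refine ⟨(1 - ρ / ‖y‖) • y, ?_, ?_⟩
  · have hone : 1 ≤ ρ / ‖y‖ := (one_le_div hnorm).2 hy
    rw [norm_smul, Real.norm_of_nonpos (by linarith), neg_sub, sub_mul, div_mul_cancel₀ _ hnorm.ne']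
    linarith
  · rw [sub_smul, one_smul, sub_sub_cancel_left, norm_neg, norm_smul,
      Real.norm_of_nonneg (by positivity), div_mul_cancel₀ _ hnorm.ne']

end Slope

section Loss

variable {m : ℕ} {ψ : ℝ → ℝ} {r₀ : ℝ} {ℓ : Vec m → ℝ}

theorem norm_gradient (ℓ : Vec m → ℝ) (v : Vec m) : ‖gradient ℓ v‖ = ‖fderiv ℝ ℓ v‖ :=
  LinearIsometryEquiv.norm_map _ _

theorem IsKL.nonneg (h : IsKL ψ r₀ ℓ) (v : Vec m) : 0 ≤ ℓ v :=
  h.min_eq.2 ⟨v, rfl⟩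

theorem IsKL.psi_le_psi (h : IsKL ψ r₀ ℓ) {a b : ℝ} (ha : 0 ≤ a) (hab : a ≤ b) (hb : b < r₀) :
    ψ a ≤ ψ b :=
  h.psi_strictMonoOn.monotoneOn ⟨ha, hab.trans_lt hb⟩ ⟨ha.trans hab, hb⟩ hab

theorem IsKL.psi_nonneg (h : IsKL ψ r₀ ℓ) {a : ℝ} (ha : 0 ≤ a) (har : a < r₀) : 0 ≤ ψ a :=
  h.psi_zero.symm.trans_le (h.psi_le_psi le_rfl ha har)

theorem IsKL.exists_hasFDerivAt_comp (h : IsKL ψ r₀ ℓ) {w : Vec m} (hw : 0 < ℓ w)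
    (hwr : ℓ w < r₀) :
    ∃ f' : Vec m →L[ℝ] ℝ, HasFDerivAt (ψ ∘ ℓ) f' w ∧ 1 ≤ ‖f'‖ := by
  have hψ : DifferentiableAt ℝ ψ (ℓ w) :=
    (h.psi_contDiffOn.differentiableOn one_ne_zero).differentiableAt (Ioo_mem_nhds hw hwr)
  have hℓ : DifferentiableAt ℝ ℓ w := h.contDiff.differentiable one_ne_zero w
  refine ⟨_, hψ.hasDerivAt.comp_hasFDerivAt w hℓ.hasFDerivAt, ?_⟩
  rw [norm_smul, ← norm_gradient]
  exact (h.ineq w hw hwr).trans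
    (mul_le_mul_of_nonneg_right (le_abs_self _) (norm_nonneg _))

-- Otherwise the variational principle, applied to `ψ ∘ ℓ` on the largest ball about `z` free of
-- minimizers, gives a point where the slope of `ψ ∘ ℓ` is less than `1`. Truncating `ℓ` at `ℓ z`
-- keeps it in the domain of `ψ`.
theorem IsKL.infDist_le (h : IsKL ψ r₀ ℓ) {z : Vec m} (hz : ℓ z < r₀) :
    infDist z {v | ℓ v = 0} ≤ ψ (ℓ z) := by
  by_contra! hlt
  set ρ := infDist z {v | ℓ v = 0}
  set F : Vec m → ℝ := fun v => ψ (min (ℓ v) (ℓ z)) with hF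
  have hψz : 0 ≤ ψ (ℓ z) := h.psi_nonneg (h.nonneg z) hz
  have hmin_mem : ∀ v, min (ℓ v) (ℓ z) ∈ Ico 0 r₀ := fun v =>
    ⟨le_min (h.nonneg v) (h.nonneg z), (min_le_right _ _).trans_lt hz⟩
  have hFcont : Continuous F := h.psi_continuousOn.comp_continuous
    (h.contDiff.continuous.min continuous_const) hmin_mem
  have hρ : 0 < ρ := hψz.trans_lt hlt
  obtain ⟨c, hc, hc1⟩ := exists_between ((div_lt_one hρ).2 hlt)
  have hc0 : 0 < c := (div_nonneg hψz hρ.le).trans_lt hc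
  have hFz : F z = ψ (ℓ z) := by simp only [hF, min_self]
  obtain ⟨w, hw, hwz, hlocal⟩ := exists_isLocalMin_add_mul_dist hFcont.continuousOn
    (fun v _ => h.psi_nonneg (hmin_mem v).1 (hmin_mem v).2) hρ.le
    (by rw [hFz]; exact (div_lt_iff₀ hρ).1 hc)
  have hw0 : 0 < ℓ w := (h.nonneg w).lt_of_ne' fun hw0 =>
    (mem_ball'.1 hw).not_ge (infDist_le_dist_of_mem hw0)
  have hwle : ℓ w ≤ ℓ z := by
    by_contra! hzw
    have hFw : F w = F z := by simp only [hF, min_eq_right hzw.le, min_self]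
    have hdist : dist w z ≤ 0 := nonpos_of_mul_nonpos_right (by linarith) hc0
    exact hzw.ne' (congrArg ℓ (dist_le_zero.1 hdist))
  have hwr := hwle.trans_lt hz
  have hlocal' : IsLocalMin (fun v => (ψ ∘ ℓ) v + c * dist v w) w := by
    filter_upwards [hlocal, h.contDiff.continuous.continuousAt.eventually_lt_const hwr]
      with v hv hvr
    have hFw : F w = ψ (ℓ w) := by simp only [hF, min_eq_left hwle]
    have hFv : F v ≤ ψ (ℓ v) := h.psi_le_psi (hmin_mem v).1 (min_le_left _ _) hvr
    simp only [Function.comp_apply]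
    linarith
  obtain ⟨f', hf', hf'1⟩ := h.exists_hasFDerivAt_comp hw0 hwr
  exact (hf'1.trans (norm_le_of_isLocalMin_add_mul_dist hc0.le hf' hlocal')).not_gt hc1

theorem gradRatio_nonneg (ℓ : Vec m → ℝ) (y : Vec m) (ρ : ℝ) : 0 ≤ gradRatio ℓ y ρ := by
  refine Real.sSup_nonneg ?_
  rintro _ ⟨v, -, rfl⟩
  positivity

/-- The supremum `L_{ℓ,0}` over the ball of radius `ρ`, that is `gradRatio ℓ y ρ`, is finite
(`sSup` has the value `0` on unbounded sets). -/
def BddGradRatio (ℓ : Vec m → ℝ) (y : Vec m) (ρ : ℝ) : Prop :=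
  BddAbove ((fun v => ‖gradient ℓ v‖ / ‖v - y‖) '' (closedBall 0 ρ \ {y}))

theorem IsKL.gradient_eq_zero (h : IsKL ψ r₀ ℓ) {y : Vec m} (hy : ℓ y = 0) :
    gradient ℓ y = 0 := by
  have hmin : IsLocalMin ℓ y := Filter.Eventually.of_forall fun v => hy.trans_le (h.nonneg v)
  rw [← norm_eq_zero, norm_gradient, hmin.fderiv_eq_zero, norm_zero]

theorem bddGradRatio_of_lipschitzOnWith {y : Vec m} {ρ : ℝ} {K : ℝ≥0}
    (hK : LipschitzOnWith K (gradient ℓ) (closedBall 0 ρ)) (hy : ‖y‖ ≤ ρ)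
    (hgrad : gradient ℓ y = 0) : BddGradRatio ℓ y ρ := by
  refine ⟨K, ?_⟩
  rintro _ ⟨v, ⟨hv, hvy⟩, rfl⟩
  refine (div_le_iff₀ (norm_pos_iff.2 (sub_ne_zero.2 hvy))).2 ?_
  simpa [hgrad, dist_eq_norm] using hK.dist_le_mul v hv y (mem_closedBall_zero_iff.2 hy)

theorem BddGradRatio.norm_gradient_le {y : Vec m} {ρ : ℝ} (hb : BddGradRatio ℓ y ρ)
    (hgrad : gradient ℓ y = 0) {v : Vec m} (hv : ‖v‖ ≤ ρ) :
    ‖gradient ℓ v‖ ≤ gradRatio ℓ y ρ * ‖v - y‖ := by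
  rcases eq_or_ne v y with rfl | hvy
  · simp [hgrad]
  rw [← div_le_iff₀ (norm_pos_iff.2 (sub_ne_zero.2 hvy))]
  exact le_csSup hb ⟨v, ⟨mem_closedBall_zero_iff.2 hv, hvy⟩, rfl⟩

theorem IsKL.le_half_gradRatio_mul_sq (h : IsKL ψ r₀ ℓ) {y v : Vec m} {ρ : ℝ}
    (hb : BddGradRatio ℓ y ρ) (hy0 : ℓ y = 0) (hy : ‖y‖ ≤ ρ) (hv : ‖v‖ ≤ ρ) (hvy : ‖v - y‖ ≤ ρ) :
    ℓ v ≤ gradRatio ℓ y ρ / 2 * ρ ^ 2 := by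
  have hquad : ℓ v ≤ ℓ y + gradRatio ℓ y ρ / 2 * ‖v - y‖ ^ 2 :=
    le_add_half_mul_norm_sub_sq
      ((convex_closedBall (0 : Vec m) ρ).starConvex (mem_closedBall_zero_iff.2 hy))
      (mem_closedBall_zero_iff.2 hv) (fun w _ => h.contDiff.differentiable one_ne_zero w)
      fun w hw => (norm_gradient ℓ w).symm.trans_le
        (hb.norm_gradient_le (h.gradient_eq_zero hy0) (mem_closedBall_zero_iff.1 hw))
  rw [hy0, zero_add] at hquad
  have := gradRatio_nonneg ℓ y ρ
  exact hquad.trans (by gcongr)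

theorem IsKL.le_psi_of_unique [NeZero m] (h : IsKL ψ r₀ ℓ) {y : Vec m} {ρ : ℝ}
    (hb : BddGradRatio ℓ y ρ) (hy0 : ℓ y = 0) (hy : ‖y‖ ≤ ρ) (huniq : ∀ v, ℓ v = 0 → v = y)
    (ha : gradRatio ℓ y ρ / 2 * ρ ^ 2 < r₀) : ρ ≤ ψ (gradRatio ℓ y ρ / 2 * ρ ^ 2) := by
  obtain ⟨z, hz, hzy⟩ := exists_norm_le_and_norm_sub_eq hy
  have hℓz := h.le_half_gradRatio_mul_sq hb hy0 hy hz hzy.le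
  have hzero : {v | ℓ v = 0} = {y} := by
    ext v
    exact ⟨huniq v, fun hv => hv.symm ▸ hy0⟩
  calc ρ = infDist z {v | ℓ v = 0} := by rw [hzero, infDist_singleton, dist_eq_norm, hzy]
    _ ≤ ψ (ℓ z) := h.infDist_le (hℓz.trans_lt ha)
    _ ≤ ψ (gradRatio ℓ y ρ / 2 * ρ ^ 2) := h.psi_le_psi (h.nonneg z) hℓz ha

end Loss

section Cosh

theorem hasSum_cosh_sqrt {t : ℝ} (ht : 0 ≤ t) :
    HasSum (fun n : ℕ => t ^ n / ((2 * n).factorial : ℝ)) (Real.cosh √t) := by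
  simpa only [pow_mul, Real.sq_sqrt ht] using Real.hasSum_cosh √t

theorem convexOn_cosh_sqrt : ConvexOn ℝ (Ici 0) fun t : ℝ => Real.cosh √t := by
  refine ⟨convex_Ici 0, fun x hx y hy a b ha hb hab => ?_⟩
  have hxy : (0 : ℝ) ≤ a • x + b • y := (convex_Ici 0) hx hy ha hb hab
  refine hasSum_le (fun n => ?_) (hasSum_cosh_sqrt hxy)
    (((hasSum_cosh_sqrt hx).const_smul a).add ((hasSum_cosh_sqrt hy).const_smul b))
  have hpow := (convexOn_pow (𝕜 := ℝ) n).2 hx hy ha hb hab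
  simp only [smul_eq_mul] at hpow ⊢
  rw [mul_div_assoc', mul_div_assoc', ← add_div]
  gcongr

theorem cosh_le_of_sq_le {r p b τ : ℝ} (hr : 0 ≤ r) (hτ : |τ| ≤ 1)
    (h : r ^ 2 ≤ p ^ 2 + b ^ 2 + 2 * p * b * τ) :
    Real.cosh r ≤ Real.cosh p * Real.cosh b + τ * (Real.sinh p * Real.sinh b) := by
  obtain ⟨hτ₁, hτ₂⟩ := abs_le.1 hτ
  -- The right-hand side interpolates linearly in `τ` between `cosh (p + b)` and `cosh (p - b)`.
  have hconv := convexOn_cosh_sqrt.2 (sq_nonneg (p + b)) (sq_nonneg (p - b))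
    (by linarith : 0 ≤ (1 + τ) / 2) (by linarith : 0 ≤ (1 - τ) / 2) (by ring)
  simp only [smul_eq_mul, Real.sqrt_sq_eq_abs, Real.cosh_abs] at hconv
  calc Real.cosh r ≤ Real.cosh √((1 + τ) / 2 * (p + b) ^ 2 + (1 - τ) / 2 * (p - b) ^ 2) := by
        rw [Real.cosh_le_cosh, abs_of_nonneg hr, abs_of_nonneg (Real.sqrt_nonneg _)]
        exact Real.le_sqrt_of_sq_le (h.trans_eq (by ring))
    _ ≤ (1 + τ) / 2 * Real.cosh (p + b) + (1 - τ) / 2 * Real.cosh (p - b) := hconv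
    _ = _ := by rw [Real.cosh_add, Real.cosh_sub]; ring

variable {E : Type*} [NormedAddCommGroup E] [InnerProductSpace ℝ E]

theorem norm_sinh_norm_div_norm_smul (x : E) :
    ‖(Real.sinh ‖x‖ / ‖x‖) • x‖ = Real.sinh ‖x‖ := by
  rcases eq_or_ne x 0 with rfl | hx
  · simp
  · rw [norm_smul, norm_div, norm_norm, div_mul_cancel₀ _ (norm_ne_zero_iff.2 hx),
      Real.norm_of_nonneg (Real.sinh_nonneg_iff.2 (norm_nonneg x))]

theorem cosh_norm_add_le {x y : E} {b : ℝ} (hy : ‖y‖ ≤ b) :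
    Real.cosh ‖x + y‖ ≤ Real.cosh ‖x‖ * Real.cosh b +
      inner ℝ ((Real.sinh ‖x‖ / ‖x‖) • x) y * (Real.sinh b / b) := by
  have hb : 0 ≤ b := (norm_nonneg y).trans hy
  rcases eq_or_ne x 0 with rfl | hx
  · simpa [abs_of_nonneg hb] using hy
  rcases hb.eq_or_lt with rfl | hb'
  · simp [norm_le_zero_iff.1 hy]
  have hcos : |inner ℝ x y / (‖x‖ * b)| ≤ 1 := by
    rw [abs_div, abs_of_pos (by positivity : 0 < ‖x‖ * b), div_le_one (by positivity)]
    exact (abs_real_inner_le_norm x y).trans (by gcongr)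
  have hsq : ‖x + y‖ ^ 2 ≤ ‖x‖ ^ 2 + b ^ 2 + 2 * ‖x‖ * b * (inner ℝ x y / (‖x‖ * b)) :=
    calc ‖x + y‖ ^ 2 = ‖x‖ ^ 2 + ‖y‖ ^ 2 + 2 * inner ℝ x y := by rw [norm_add_sq_real]; ring
      _ ≤ ‖x‖ ^ 2 + b ^ 2 + 2 * inner ℝ x y := by gcongr
      _ = _ := by field_simp
  refine (cosh_le_of_sq_le (norm_nonneg _) hcos hsq).trans_eq ?_
  rw [real_inner_smul_left]
  field_simp

end Cosh

section Concentration

variable {Ω ι E : Type*} [MeasurableSpace Ω] {P : Measure Ω} [IsProbabilityMeasure P]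
  [NormedAddCommGroup E] [SecondCountableTopology E] [MeasurableSpace E] [BorelSpace E]
  {Y : ι → Ω → E} {b : ι → ℝ}

theorem integrable_cosh_norm_sum (hm : ∀ j, AEMeasurable (Y j) P)
    (hb : ∀ j, ∀ᵐ ω ∂P, ‖Y j ω‖ ≤ b j) (s : Finset ι) :
    Integrable (fun ω => Real.cosh ‖∑ j ∈ s, Y j ω‖) P := by
  have hae : ∀ᵐ ω ∂P, ∀ j ∈ s, ‖Y j ω‖ ≤ b j := (ae_ball_iff s.countable_toSet).2 fun j _ => hb j
  have hsum : AEMeasurable (fun ω => ∑ j ∈ s, Y j ω) P :=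
    Finset.aemeasurable_fun_sum s fun j _ => hm j
  refine Integrable.of_bound
    (Real.continuous_cosh.measurable.comp_aemeasurable hsum.norm).aestronglyMeasurable
    (Real.cosh (∑ j ∈ s, b j)) ?_
  filter_upwards [hae] with ω hω
  rw [Real.norm_of_nonneg (Real.cosh_pos _).le, Real.cosh_le_cosh, abs_of_nonneg (norm_nonneg _)]
  exact (norm_sum_le_of_le s hω).trans (le_abs_self _)

variable [InnerProductSpace ℝ E] [CompleteSpace E]

theorem integral_cosh_norm_add_le {X Y : Ω → E} (hXY : IndepFun X Y P) (hX : AEMeasurable X P)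
    (hXint : Integrable (fun ω => Real.cosh ‖X ω‖) P) (hY : AEMeasurable Y P) {b : ℝ}
    (hb : ∀ᵐ ω ∂P, ‖Y ω‖ ≤ b) (hY0 : ∫ ω, Y ω ∂P = 0) :
    ∫ ω, Real.cosh ‖X ω + Y ω‖ ∂P ≤ (∫ ω, Real.cosh ‖X ω‖ ∂P) * Real.cosh b := by
  set F : E → E := fun x => (Real.sinh ‖x‖ / ‖x‖) • x
  have hF : Measurable F := by
    have := Real.continuous_sinh.measurable.comp (measurable_norm (α := E))
    exact (this.div measurable_norm).smul measurable_id
  have hFX : Integrable (fun ω => F (X ω)) P := by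
    refine hXint.mono' (hF.comp_aemeasurable hX).aestronglyMeasurable (ae_of_all _ fun ω => ?_)
    rw [norm_sinh_norm_div_norm_smul]
    exact (Real.sinh_lt_cosh _).le
  have hYint : Integrable Y P := Integrable.of_bound hY.aestronglyMeasurable b hb
  have hind : IndepFun (fun ω => F (X ω)) Y P := hXY.comp hF measurable_id
  have hint : Integrable (fun ω => inner ℝ (F (X ω)) (Y ω)) P :=
    hind.integrable_bilin hFX hYint (innerSL ℝ)
  have hzero : ∫ ω, inner ℝ (F (X ω)) (Y ω) ∂P = 0 :=
    (hind.integral_bilin hFX hYint (innerSL ℝ)).trans (by rw [hY0, map_zero])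
  calc ∫ ω, Real.cosh ‖X ω + Y ω‖ ∂P
      ≤ ∫ ω, (Real.cosh ‖X ω‖ * Real.cosh b + inner ℝ (F (X ω)) (Y ω) * (Real.sinh b / b)) ∂P :=
        integral_mono_of_nonneg (ae_of_all _ fun _ => (Real.cosh_pos _).le)
          ((hXint.mul_const _).add (hint.mul_const _)) (hb.mono fun _ hω => cosh_norm_add_le hω)
    _ = (∫ ω, Real.cosh ‖X ω‖ ∂P) * Real.cosh b := by
        rw [integral_add (hXint.mul_const _) (hint.mul_const _), integral_mul_const,
          integral_mul_const, hzero, zero_mul, add_zero]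

theorem integral_cosh_norm_sum_le (hm : ∀ j, AEMeasurable (Y j) P) (hind : iIndepFun Y P)
    (hb : ∀ j, ∀ᵐ ω ∂P, ‖Y j ω‖ ≤ b j) (h0 : ∀ j, ∫ ω, Y j ω ∂P = 0) (s : Finset ι) :
    ∫ ω, Real.cosh ‖∑ j ∈ s, Y j ω‖ ∂P ≤ Real.exp (∑ j ∈ s, b j ^ 2 / 2) := by
  classical
  induction s using Finset.induction_on with
  | empty => simp
  | insert a s ha ih =>
    have hsum : IndepFun (fun ω => ∑ j ∈ s, Y j ω) (Y a) P := by
      simpa only [Finset.sum_fn] using hind.indepFun_finsetSum_of_notMem₀ hm ha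
    calc ∫ ω, Real.cosh ‖∑ j ∈ insert a s, Y j ω‖ ∂P
        = ∫ ω, Real.cosh ‖∑ j ∈ s, Y j ω + Y a ω‖ ∂P := by
          simp only [Finset.sum_insert ha, add_comm]
      _ ≤ (∫ ω, Real.cosh ‖∑ j ∈ s, Y j ω‖ ∂P) * Real.cosh (b a) :=
          integral_cosh_norm_add_le hsum (Finset.aemeasurable_fun_sum s fun j _ => hm j)
            (integrable_cosh_norm_sum hm hb s) (hm a) (hb a) (h0 a)
      _ ≤ Real.exp (∑ j ∈ s, b j ^ 2 / 2) * Real.exp (b a ^ 2 / 2) := by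
          gcongr
          exact Real.cosh_le_exp_half_sq _
      _ = Real.exp (∑ j ∈ insert a s, b j ^ 2 / 2) := by
          rw [← Real.exp_add, Finset.sum_insert ha, add_comm]

variable [Fintype ι]

theorem cosh_mul_measureReal_norm_sum_ge_le (hm : ∀ j, AEMeasurable (Y j) P)
    (hind : iIndepFun Y P) (hb : ∀ j, ∀ᵐ ω ∂P, ‖Y j ω‖ ≤ b j) (h0 : ∀ j, ∫ ω, Y j ω ∂P = 0)
    {l t : ℝ} (hl : 0 ≤ l) (ht : 0 ≤ t) :
    Real.cosh (l * t) * P.real {ω | t ≤ ‖∑ j, Y j ω‖} ≤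
      Real.exp (l ^ 2 * (∑ j, b j ^ 2) / 2) := by
  have hlm : ∀ j, AEMeasurable (fun ω => l • Y j ω) P := fun j => (hm j).const_smul l
  have hlb : ∀ j, ∀ᵐ ω ∂P, ‖l • Y j ω‖ ≤ l * b j := fun j => (hb j).mono fun ω hω => by
    rw [norm_smul, Real.norm_of_nonneg hl]
    gcongr
  have hsub : {ω | t ≤ ‖∑ j, Y j ω‖} ⊆
      {ω | Real.cosh (l * t) ≤ Real.cosh ‖∑ j, l • Y j ω‖} := fun ω (hω : t ≤ _) => by
    rw [mem_ofPred_eq, ← Finset.smul_sum, norm_smul, Real.norm_of_nonneg hl, Real.cosh_le_cosh,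
      abs_of_nonneg (by positivity), abs_of_nonneg (by positivity)]
    gcongr
  calc Real.cosh (l * t) * P.real {ω | t ≤ ‖∑ j, Y j ω‖}
      ≤ Real.cosh (l * t) * P.real {ω | Real.cosh (l * t) ≤ Real.cosh ‖∑ j, l • Y j ω‖} :=
        mul_le_mul_of_nonneg_left (measureReal_mono hsub) (Real.cosh_pos _).le
    _ ≤ ∫ ω, Real.cosh ‖∑ j, l • Y j ω‖ ∂P :=
        mul_meas_ge_le_integral_of_nonneg (ae_of_all _ fun _ => (Real.cosh_pos _).le)
          (integrable_cosh_norm_sum hlm hlb Finset.univ) _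
    _ ≤ Real.exp (∑ j, (l * b j) ^ 2 / 2) :=
        integral_cosh_norm_sum_le hlm
          (hind.comp (fun _ x => l • x) fun _ => measurable_const_smul l) hlb
          (fun j => by rw [integral_smul, h0, smul_zero]) Finset.univ
    _ = Real.exp (l ^ 2 * (∑ j, b j ^ 2) / 2) := by
        simp only [mul_pow, ← Finset.sum_div, ← Finset.mul_sum]

theorem measureReal_norm_sum_ge_le (hm : ∀ j, AEMeasurable (Y j) P) (hind : iIndepFun Y P)
    (hb : ∀ j, ∀ᵐ ω ∂P, ‖Y j ω‖ ≤ b j) (h0 : ∀ j, ∫ ω, Y j ω ∂P = 0) {β t : ℝ}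
    (hβ : ∑ j, b j ^ 2 ≤ β) (ht : 0 ≤ t) :
    P.real {ω | t ≤ ‖∑ j, Y j ω‖} ≤ 2 * Real.exp (-(t ^ 2 / (2 * β))) := by
  have hβ0 : 0 ≤ β := (Finset.sum_nonneg fun j _ => sq_nonneg (b j)).trans hβ
  have hcosh : Real.exp (t / β * t) / 2 ≤ Real.cosh (t / β * t) := by
    rw [Real.cosh_eq]
    linarith [Real.exp_pos (-(t / β * t))]
  refine le_of_mul_le_mul_left ?_ (half_pos (Real.exp_pos (t / β * t)))
  calc Real.exp (t / β * t) / 2 * P.real {ω | t ≤ ‖∑ j, Y j ω‖}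
      ≤ Real.cosh (t / β * t) * P.real {ω | t ≤ ‖∑ j, Y j ω‖} := by gcongr
    _ ≤ Real.exp ((t / β) ^ 2 * (∑ j, b j ^ 2) / 2) :=
        cosh_mul_measureReal_norm_sum_ge_le hm hind hb h0 (by positivity) ht
    _ ≤ Real.exp ((t / β) ^ 2 * β / 2) := by gcongr
    _ = Real.exp (t / β * t) * Real.exp (-(t ^ 2 / (2 * β))) := by
        rw [← Real.exp_add]
        congr 1
        rcases eq_or_ne β 0 with rfl | hβ'
        · simp
        · field_simp
          ring
    _ = _ := by ring

end Concentration

section Independence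

variable {Ω : Type*} [MeasurableSpace Ω] {P : Measure Ω}

theorem indepFun_row {ι κ β : Type*} [Finite κ] [MeasurableSpace β] {X : ι × κ → Ω → β}
    (hind : iIndepFun X P) (hX : ∀ p, AEMeasurable (X p) P) {i j : ι} (hij : i ≠ j) :
    IndepFun (fun ω l => X (i, l) ω) (fun ω l => X (j, l) ω) P := by
  classical
  have := Fintype.ofFinite κ
  have hdisj : Disjoint (({i} : Finset ι) ×ˢ (Finset.univ : Finset κ)) ({j} ×ˢ Finset.univ) :=
    Finset.disjoint_product.2 (Or.inl (Finset.disjoint_singleton.2 hij))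
  have hrow (a : ι) : Measurable fun (x : (({a} ×ˢ Finset.univ : Finset (ι × κ)) → β)) l =>
      x ⟨(a, l), by simp⟩ := by fun_prop
  exact (hind.indepFun_finset₀ _ _ hdisj hX).comp (hrow i) (hrow j)

theorem measureReal_prodMk_mem_le [IsProbabilityMeasure P] {α β : Type*} [MeasurableSpace α]
    [MeasurableSpace β] {X : Ω → α} {Y : Ω → β} (hX : AEMeasurable X P) (hY : AEMeasurable Y P)
    (hXY : IndepFun X Y P) {S : Set (α × β)} (hS : MeasurableSet S) {b : ℝ}
    (hb : ∀ᵐ ω ∂P, P.real {ω' | (X ω', Y ω) ∈ S} ≤ b) :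
    P.real {ω | (X ω, Y ω) ∈ S} ≤ b := by
  have hb0 : 0 ≤ b := let ⟨_, hω⟩ := hb.exists; measureReal_nonneg.trans hω
  have hslice (y : β) : P.map X ((fun x => (x, y)) ⁻¹' S) = P {ω | (X ω, y) ∈ S} :=
    Measure.map_apply_of_aemeasurable hX (measurable_prodMk_right hS)
  have := Measure.isProbabilityMeasure_map hX
  have := Measure.isProbabilityMeasure_map hY
  refine ENNReal.toReal_le_of_le_ofReal hb0 ?_
  calc P {ω | (X ω, Y ω) ∈ S} = (P.map X).prod (P.map Y) S := by
        rw [← (indepFun_iff_map_prod_eq_prod_map_map hX hY).1 hXY,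
          Measure.map_apply_of_aemeasurable (hX.prodMk hY) hS]
        rfl
    _ = ∫⁻ ω, P.map X ((fun x => (x, Y ω)) ⁻¹' S) ∂P := by
        rw [Measure.prod_apply_symm hS,
          lintegral_map' (measurable_measure_prodMk_right hS).aemeasurable hY]
    _ ≤ ∫⁻ _, ENNReal.ofReal b ∂P := lintegral_mono_ae (hb.mono fun ω hω => by
        rw [hslice, ← ofReal_measureReal]
        exact ENNReal.ofReal_le_ofReal hω)
    _ = ENNReal.ofReal b := by simp

theorem measureReal_abs_sum_comp_sub_ge_le [IsProbabilityMeasure P] {ι 𝓧 : Type*} [Fintype ι]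
    [MeasurableSpace 𝓧] {μ : Measure 𝓧} {Z : ι → Ω → 𝓧} (hZ : ∀ j, HasLaw (Z j) μ P)
    (hind : Pairwise fun i j => IndepFun (Z i) (Z j) P) {f : 𝓧 → ℝ} (hf : Measurable f)
    (hf2 : MemLp f 2 μ) {δ : ℝ} (hδ : 0 < δ) :
    P.real {ω | δ ≤ |∑ j, f (Z j ω) - Fintype.card ι * ∫ x, f x ∂μ|} ≤
      Fintype.card ι * variance f μ / δ ^ 2 := by
  have hmem (j : ι) : MemLp (f ∘ Z j) 2 P :=
    MemLp.comp_of_map ((hZ j).map_eq ▸ hf2) (hZ j).aemeasurable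
  have hmean : ∫ ω, (∑ j, f ∘ Z j) ω ∂P = Fintype.card ι * ∫ x, f x ∂μ := by
    simp only [Finset.sum_apply]
    rw [integral_finsetSum _ fun j _ => (hmem j).integrable one_le_two,
      Finset.sum_congr rfl fun j _ => (hZ j).integral_comp hf.aestronglyMeasurable]
    simp
  have hvar (j : ι) : variance (f ∘ Z j) P = variance f μ := by
    rw [← (hZ j).map_eq, variance_map hf.aemeasurable (hZ j).aemeasurable]
  have hsum : variance (∑ j, f ∘ Z j) P = Fintype.card ι * variance f μ := by
    rw [IndepFun.variance_sum (fun j _ => hmem j) fun i _ j _ hij => (hind hij).comp hf hf]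
    simp [hvar]
  have hcheb := meas_ge_le_variance_div_sq (memLp_finsetSum' Finset.univ fun j _ => hmem j) hδ
  rw [hsum, hmean] at hcheb
  simp only [Finset.sum_apply, Function.comp_apply] at hcheb
  exact ENNReal.toReal_le_of_le_ofReal
    (div_nonneg (mul_nonneg (Nat.cast_nonneg _) (variance_nonneg f μ)) (sq_nonneg δ)) hcheb

theorem exists_measurableSet_of_measureReal_not_le [IsProbabilityMeasure P] {p q : Ω → Prop}
    {δ : ℝ} (hp : P.real {ω | ¬p ω} ≤ δ) (hpq : ∀ᵐ ω ∂P, p ω → q ω) :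
    ∃ E, MeasurableSet E ∧ 1 - δ ≤ P.real E ∧ ∀ ω ∈ E, q ω := by
  have hqp : P {ω | ¬q ω} ≤ P {ω | ¬p ω} := measure_mono_ae (hpq.mono fun _ hω => mt hω)
  refine ⟨(toMeasurable P {ω | ¬q ω})ᶜ, (measurableSet_toMeasurable _ _).compl, ?_, fun ω hω => ?_⟩
  · rw [probReal_compl_eq_one_sub (measurableSet_toMeasurable _ _), measureReal_def,
      measure_toMeasurable]
    exact sub_le_sub_left ((ENNReal.toReal_mono (measure_ne_top _ _) hqp).trans hp) 1
  · exact not_not.1 fun hq => hω (subset_toMeasurable _ _ hq)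

end Independence

section Gaussian

variable {φ : ℝ → ℝ} {B : ℝ≥0}

theorem memLp_gaussianReal_of_lipschitzWith (hφ : LipschitzWith B φ) {p : ℝ≥0∞} (hp : p ≠ ∞)
    (μ : ℝ) (v : ℝ≥0) : MemLp φ p (gaussianReal μ v) := by
  have hsub : LipschitzWith B fun x => φ x - φ 0 :=
    LipschitzWith.of_dist_le_mul fun x y => by simpa using hφ.dist_le_mul x y
  simpa [Function.comp_def, Pi.add_def] using
    (hsub.comp_memLp (sub_self _) (memLp_id_gaussianReal' (μ := μ) (v := v) p hp)).add
      (memLp_const (φ 0))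

theorem memLp_sq_gaussianReal (hφ : LipschitzWith B φ) (μ : ℝ) (v : ℝ≥0) :
    MemLp (fun x => φ x ^ 2) 2 (gaussianReal μ v) := by
  have h4 := memLp_gaussianReal_of_lipschitzWith hφ (p := 4) ENNReal.ofNat_ne_top μ v
  have : ENNReal.HolderTriple 4 4 2 := ⟨by
    rw [← two_mul, show (4 : ℝ≥0∞) = 2 * 2 by norm_num, ENNReal.mul_inv (by simp) (by simp),
      ← mul_assoc, ENNReal.mul_inv_cancel (by simp) (by simp), one_mul]⟩
  simpa only [sq] using h4.mul' h4 (r := 2)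

theorem integral_sq_gaussianReal_pos (hφ : LipschitzWith B φ) (hφ0 : φ ≠ 0) {μ : ℝ} {v : ℝ≥0}
    (hv : v ≠ 0) : 0 < ∫ x, φ x ^ 2 ∂gaussianReal μ v := by
  rw [integral_pos_iff_support_of_nonneg (fun x => sq_nonneg _)
    ((memLp_sq_gaussianReal hφ μ v).integrable one_le_two)]
  obtain ⟨t, ht⟩ := Function.ne_iff.1 hφ0
  have hvol : volume (Function.support fun x => φ x ^ 2) ≠ 0 :=
    ((hφ.continuous.pow 2).isOpen_support.measure_pos volume ⟨t, pow_ne_zero 2 ht⟩).ne'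
  exact pos_iff_ne_zero.2 fun h => hvol (gaussianReal_absolutelyContinuous' μ hv h)

variable {Ω : Type*} [MeasurableSpace Ω] {P : Measure Ω} [IsProbabilityMeasure P]

theorem hasLaw_sum_gaussianReal {ι : Type*} {X : ι → Ω → ℝ} {μ : ι → ℝ} {v : ι → ℝ≥0}
    (hX : ∀ i, HasLaw (X i) (gaussianReal (μ i) (v i)) P) (hind : iIndepFun X P) (s : Finset ι) :
    HasLaw (∑ i ∈ s, X i) (gaussianReal (∑ i ∈ s, μ i) (∑ i ∈ s, v i)) P := by
  classical
  induction s using Finset.induction_on with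
  | empty => simpa using hasLaw_dirac_of_ae_eq (X := (0 : Ω → ℝ)) (x := 0) (.refl _ _)
  | insert a s ha ih =>
    have hind' := (hind.indepFun_finsetSum_of_notMem₀ (fun i => (hX i).aemeasurable) ha).symm
    simp only [Finset.sum_insert ha]
    exact ⟨(hX a).aemeasurable.add ih.aemeasurable,
      gaussianReal_add_gaussianReal_of_indepFun hind' (hX a).map_eq ih.map_eq⟩

theorem hasLaw_sum_mul_gaussianReal {ι : Type*} [Fintype ι] {X : ι → Ω → ℝ}
    (hX : ∀ i, HasLaw (X i) (gaussianReal 0 1) P) (hind : iIndepFun X P)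
    {u : EuclideanSpace ℝ ι} (hu : ‖u‖ = 1) :
    HasLaw (fun ω => ∑ i, X i ω * u i) (gaussianReal 0 1) P := by
  have hvar : ∑ i, NNReal.mk (u i ^ 2) (sq_nonneg _) * 1 = 1 := by
    ext
    simp [← EuclideanSpace.real_norm_sq_eq, hu]
  have hsum := hasLaw_sum_gaussianReal (fun i => gaussianReal_mul_const (hX i) (u i))
    (hind.comp (fun i x => x * u i) fun i => measurable_id.mul_const _) Finset.univ
  rw [hvar] at hsum
  simpa [Finset.sum_fn] using hsum

end Gaussian

section Initialization

variable {Ω : Type*} [MeasurableSpace Ω] {P : Measure Ω} {n k d : ℕ} {D : ℝ} {u : Ω → Vec d}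
  {W : Ω → Fin k → Fin d → ℝ} {V : Ω → Fin n → Fin k → ℝ}

/-- The part of `IsInit` that the estimates rest on: the input is any random unit vector, and the
columns of `V` are independent with centered bounded entries, but neither identically distributed
nor normalized to have identity covariance. -/
structure IsBoundedInit (P : Measure Ω) (D : ℝ) (u : Ω → Vec d) (W : Ω → Fin k → Fin d → ℝ)
    (V : Ω → Fin n → Fin k → ℝ) : Prop where
  aemeasurable_input : AEMeasurable u P
  norm_input : ∀ᵐ ω ∂P, ‖u ω‖ = 1
  W_law : ∀ j l, HasLaw (fun ω => W ω j l) (gaussianReal 0 1) P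
  W_indep : iIndepFun (fun (p : Fin k × Fin d) ω => W ω p.1 p.2) P
  W_indep_input : IndepFun W u P
  aemeasurable_column : ∀ j, AEMeasurable (fun ω i => V ω i j) P
  V_indep : IndepFun V (fun ω => (W ω, u ω)) P
  V_col_indep : iIndepFun (fun (j : Fin k) ω (i : Fin n) => V ω i j) P
  V_bdd : ∀ᵐ ω ∂P, ∀ i j, |V ω i j| ≤ D
  V_centered : ∀ i j, ∫ ω, V ω i j ∂P = 0

theorem ae_norm_eq_one_uniformSphere (d : ℕ) : ∀ᵐ u ∂uniformSphere d, ‖u‖ = 1 := by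
  rw [uniformSphere, ae_map_iff (by fun_prop) (measurableSet_eq_fun (by fun_prop) (by fun_prop))]
  exact ae_of_all _ fun u => by simp

theorem IsInit.isBoundedInit (h : IsInit P D u W V) : IsBoundedInit P D u W V where
  aemeasurable_input := h.u_law.aemeasurable
  norm_input := ae_of_ae_map h.u_law.aemeasurable
    (h.u_law.map_eq.symm ▸ ae_norm_eq_one_uniformSphere d)
  W_law := h.W_law
  W_indep := h.W_indep
  W_indep_input := h.W_indep_u
  aemeasurable_column j := (h.V_col_ident j j).aemeasurable_fst
  V_indep := h.V_indep
  V_col_indep := h.V_col_indep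
  V_bdd := h.V_bdd
  V_centered := h.V_centered

/-- The second moment of `φ` under the standard Gaussian law, the limit of `‖φ(W u)‖² / k`. -/
noncomputable def secondMoment (φ : ℝ → ℝ) : ℝ := ∫ x, φ x ^ 2 ∂gaussianReal 0 1

theorem hidden_toParam (φ : ℝ → ℝ) (u : Vec d) (V : Fin n → Fin k → ℝ) (W : Fin k → Fin d → ℝ) :
    hidden φ u (toParam V W) = WithLp.toLp 2 fun j => φ (∑ l, W j l * u l) := rfl

theorem column_toParam (V : Fin n → Fin k → ℝ) (W : Fin k → Fin d → ℝ) (j : Fin k) :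
    column (toParam V W) j = WithLp.toLp 2 fun i => V i j := by
  ext i
  simp [column_apply, toParam]

theorem norm_le_sqrt_card_mul {ι : Type*} [Fintype ι] {v : EuclideanSpace ℝ ι} {b : ℝ}
    (hb : 0 ≤ b) (hv : ∀ i, |v i| ≤ b) : ‖v‖ ≤ √(Fintype.card ι) * b := by
  refine le_of_sq_le_sq ?_ (by positivity)
  rw [EuclideanSpace.norm_sq_eq, mul_pow, Real.sq_sqrt (by positivity)]
  calc ∑ i, ‖v i‖ ^ 2 ≤ ∑ _i : ι, b ^ 2 := by
        gcongr with i
        exact hv i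
    _ = Fintype.card ι * b ^ 2 := by simp

theorem norm_column_toParam_le {V : Fin n → Fin k → ℝ} (hD : 0 ≤ D) (hV : ∀ i j, |V i j| ≤ D)
    (W : Fin k → Fin d → ℝ) (j : Fin k) : ‖column (toParam V W) j‖ ≤ √n * D := by
  rw [column_toParam]
  simpa using norm_le_sqrt_card_mul hD fun i => hV i j

theorem measurable_hidden_toParam {φ : ℝ → ℝ} (hφ : Measurable φ) (V : Fin n → Fin k → ℝ) :
    Measurable fun p : (Fin k → Fin d → ℝ) × Vec d => hidden φ p.2 (toParam V p.1) := by
  simp only [hidden_toParam]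
  fun_prop

theorem measureReal_le_abs_norm_hidden_sub_le [IsProbabilityMeasure P] {φ : ℝ → ℝ} {B : ℝ≥0}
    (hφ : LipschitzWith B φ) (hW : ∀ j l, HasLaw (fun ω => W ω j l) (gaussianReal 0 1) P)
    (hind : iIndepFun (fun (p : Fin k × Fin d) ω => W ω p.1 p.2) P)
    {u : Vec d} (hu : ‖u‖ = 1) (V : Fin n → Fin k → ℝ) {δ : ℝ} (hδ : 0 < δ) :
    P.real {ω | δ ≤ |‖hidden φ u (toParam V (W ω))‖ ^ 2 - k * secondMoment φ|} ≤
      k * Var[fun x => φ x ^ 2; gaussianReal 0 1] / δ ^ 2 := by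
  have hlaw (j : Fin k) : HasLaw (fun ω => ∑ l, W ω j l * u l) (gaussianReal 0 1) P :=
    hasLaw_sum_mul_gaussianReal (hW j)
      (hind.precomp (g := fun l => (j, l)) fun _ _ h => (Prod.mk.inj h).2) hu
  have hpre : Measurable fun x : Fin d → ℝ => ∑ l, x l * u l := by fun_prop
  have hpair : Pairwise fun i j => IndepFun (fun ω => ∑ l, W ω i l * u l)
      (fun ω => ∑ l, W ω j l * u l) P := fun i j hij =>
    (indepFun_row hind (fun p => (hW p.1 p.2).aemeasurable) hij).comp hpre hpre
  have hcheb := measureReal_abs_sum_comp_sub_ge_le hlaw hpair (f := fun x => φ x ^ 2)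
    (hφ.continuous.measurable.pow_const 2) (memLp_sq_gaussianReal hφ 0 1) hδ
  simpa only [hidden_toParam, EuclideanSpace.real_norm_sq_eq, secondMoment, Fintype.card_fin]
    using hcheb

namespace IsBoundedInit

theorem mono {D' : ℝ} (h : IsBoundedInit P D u W V) (hD : D ≤ D') : IsBoundedInit P D' u W V :=
  { h with V_bdd := h.V_bdd.mono fun _ hω i j => (hω i j).trans hD }

theorem dim_pos [IsProbabilityMeasure P] (h : IsBoundedInit P D u W V) : 0 < d := by
  obtain ⟨ω, hω⟩ := h.norm_input.exists
  rcases Nat.eq_zero_or_pos d with rfl | hd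
  · simp [Subsingleton.elim (u ω) 0] at hω
  · exact hd

theorem aemeasurable_inner (h : IsBoundedInit P D u W V) : AEMeasurable W P :=
  aemeasurable_pi_lambda _ fun j => aemeasurable_pi_lambda _ fun l => (h.W_law j l).aemeasurable

theorem aemeasurable_outer (h : IsBoundedInit P D u W V) : AEMeasurable V P :=
  aemeasurable_pi_lambda _ fun i => aemeasurable_pi_lambda _ fun j =>
    (measurable_pi_apply i).comp_aemeasurable (h.aemeasurable_column j)

variable [IsProbabilityMeasure P]

theorem integral_column (h : IsBoundedInit P D u W V) (W₀ : Fin k → Fin d → ℝ) (j : Fin k) :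
    ∫ ω, column (toParam (V ω) W₀) j ∂P = 0 := by
  have hint (i : Fin n) : Integrable (fun ω => V ω i j) P :=
    Integrable.of_bound ((measurable_pi_apply i).comp_aemeasurable
      (h.aemeasurable_column j)).aestronglyMeasurable D (h.V_bdd.mono fun _ hω => hω i j)
  ext i
  simp only [column_toParam]
  rw [eval_integral_piLp hint, h.V_centered, PiLp.zero_apply]

theorem measureReal_le_norm_outer_le (h : IsBoundedInit P D u W V) (hD : 0 ≤ D)
    (W₀ : Fin k → Fin d → ℝ) {z : Vec k} {S t : ℝ} (hz : ‖z‖ ^ 2 ≤ S) (ht : 0 ≤ t) :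
    P.real {ω | t ≤ ‖outer (toParam (V ω) W₀) z‖} ≤
      2 * Real.exp (-(t ^ 2 / (2 * (D ^ 2 * n * S)))) := by
  have hcol (j : Fin k) : Measurable fun x : Fin n → ℝ => z j • (WithLp.toLp 2 x : Vec n) := by
    fun_prop
  have hbdd (j : Fin k) : ∀ᵐ ω ∂P, ‖z j • column (toParam (V ω) W₀) j‖ ≤ |z j| * (√n * D) :=
    h.V_bdd.mono fun ω hω => by
      rw [norm_smul, Real.norm_eq_abs]
      gcongr
      exact norm_column_toParam_le hD hω W₀ j
  have hsum : ∑ j, (|z j| * (√n * D)) ^ 2 ≤ D ^ 2 * n * S := by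
    simp only [mul_pow, sq_abs, ← Finset.sum_mul]
    rw [← EuclideanSpace.real_norm_sq_eq, Real.sq_sqrt (by positivity), mul_comm,
      mul_comm (n : ℝ)]
    gcongr
  simp only [outer_eq_sum_smul_column]
  refine measureReal_norm_sum_ge_le (fun j => ?_) ?_ hbdd (fun j => ?_) hsum ht
  · simp only [column_toParam]
    exact (hcol j).comp_aemeasurable (h.aemeasurable_column j)
  · simp only [column_toParam]
    exact h.V_col_indep.comp _ hcol
  · rw [integral_smul, h.integral_column, smul_zero]

variable {φ : ℝ → ℝ} {B : ℝ≥0}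

theorem measureReal_le_abs_norm_hidden_sub_le (h : IsBoundedInit P D u W V)
    (hφ : LipschitzWith B φ) {δ : ℝ} (hδ : 0 < δ) :
    P.real {ω | δ ≤ |‖hidden φ (u ω) (toParam (V ω) (W ω))‖ ^ 2 - k * secondMoment φ|} ≤
      k * Var[fun x => φ x ^ 2; gaussianReal 0 1] / δ ^ 2 := by
  have hm := measurable_hidden_toParam (d := d) hφ.continuous.measurable (0 : Fin n → Fin k → ℝ)
  exact measureReal_prodMk_mem_le h.aemeasurable_inner h.aemeasurable_input h.W_indep_input
    (S := {p | δ ≤ |‖hidden φ p.2 (toParam (0 : Fin n → Fin k → ℝ) p.1)‖ ^ 2 -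
      k * secondMoment φ|}) (measurableSet_le (by fun_prop) (by fun_prop))
    (h.norm_input.mono fun ω hω =>
      DIP.measureReal_le_abs_norm_hidden_sub_le hφ h.W_law h.W_indep hω 0 hδ)

theorem measureReal_le_norm_outer_hidden_le (h : IsBoundedInit P D u W V) (hD : 0 ≤ D)
    (hφ : Measurable φ) (S : ℝ) {t : ℝ} (ht : 0 ≤ t) :
    P.real {ω | ‖hidden φ (u ω) (toParam (V ω) (W ω))‖ ^ 2 ≤ S ∧
        t ≤ ‖outer (toParam (V ω) (W ω)) (hidden φ (u ω) (toParam (V ω) (W ω)))‖} ≤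
      2 * Real.exp (-(t ^ 2 / (2 * (D ^ 2 * n * S)))) := by
  set H : (Fin k → Fin d → ℝ) × Vec d → Vec k := fun p =>
    hidden φ p.2 (toParam (0 : Fin n → Fin k → ℝ) p.1)
  have hH : Measurable H := measurable_hidden_toParam hφ 0
  have hout : Measurable fun q : (Fin n → Fin k → ℝ) × ((Fin k → Fin d → ℝ) × Vec d) =>
      outer (toParam q.1 q.2.1) (H q.2) := by
    simp only [outer_eq_sum_smul_column, column_toParam]
    fun_prop
  refine measureReal_prodMk_mem_le h.aemeasurable_outer
    (h.aemeasurable_inner.prodMk h.aemeasurable_input) h.V_indep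
    (S := {q | ‖H q.2‖ ^ 2 ≤ S ∧ t ≤ ‖outer (toParam q.1 q.2.1) (H q.2)‖})
    ((measurableSet_le ((hH.comp measurable_snd).norm.pow_const 2) measurable_const).inter
      (measurableSet_le measurable_const hout.norm)) (ae_of_all _ fun ω => ?_)
  by_cases hS : ‖H (W ω, u ω)‖ ^ 2 ≤ S
  · simpa only [mem_ofPred_eq, hS, true_and] using h.measureReal_le_norm_outer_le hD (W ω) hS ht
  · simp only [mem_ofPred_eq, hS, false_and, ofPred_false, measureReal_empty]
    positivity

theorem measureReal_not_hidden_net_le (h : IsBoundedInit P D u W V) (hD : 0 ≤ D)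
    (hφ : LipschitzWith B φ) (hc : 0 < secondMoment φ) (hk : 0 < k) {r : ℝ} (hr : 0 ≤ r) :
    P.real {ω | ¬(k * secondMoment φ / 2 ≤ ‖hidden φ (u ω) (toParam (V ω) (W ω))‖ ^ 2 ∧
        ‖net φ (u ω) (toParam (V ω) (W ω))‖ ≤ r)} ≤
      4 * Var[fun x => φ x ^ 2; gaussianReal 0 1] / (secondMoment φ ^ 2 * k) +
        2 * Real.exp (-(r ^ 2 / (3 * D ^ 2 * n * secondMoment φ))) := by
  set c := secondMoment φ
  have hk' : (0 : ℝ) < k := Nat.cast_pos.2 hk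
  have hhid := h.measureReal_le_abs_norm_hidden_sub_le hφ (δ := k * c / 2) (by positivity)
  have hout := h.measureReal_le_norm_outer_hidden_le hD hφ.continuous.measurable
    (3 / 2 * (k * c)) (t := r * √k) (by positivity)
  refine (measureReal_mono fun ω hω => ?_).trans ((measureReal_union_le _ _).trans
    ((add_le_add hhid hout).trans_eq ?_))
  · by_cases hdev : k * c / 2 ≤ |‖hidden φ (u ω) (toParam (V ω) (W ω))‖ ^ 2 - k * c|
    · exact Or.inl hdev
    obtain ⟨hlow, hupp⟩ := abs_lt.1 (not_le.1 hdev)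
    refine Or.inr ⟨by linarith, le_of_not_gt fun hlt => hω ⟨by linarith, ?_⟩⟩
    rw [net_eq_smul_outer, norm_smul, Real.norm_of_nonneg (by positivity), one_div,
      inv_mul_le_iff₀ (by positivity), mul_comm]
    exact hlt.le
  · rw [mul_pow, Real.sq_sqrt hk'.le]
    congr 1
    · field_simp
      ring
    · congr 3
      field_simp

end IsBoundedInit

end Initialization

section InitBound

variable {m n : ℕ} {ψ : ℝ → ℝ} {r₀ : ℝ} {ℓ : Vec m → ℝ} {A : Vec n →L[ℝ] Vec m} {x : Vec n}
  {ε : Vec m} {C : ℝ} {d : ℕ}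

theorem dim_pos_of_ne_zero (hA : A ≠ 0) : 0 < n :=
  Nat.pos_of_ne_zero fun hn => hA <| by subst hn; exact Subsingleton.elim _ _

theorem norm_le_sqrt_mul_supNorm (v : Vec m) : ‖v‖ ≤ √m * supNorm v := by
  simpa [supNorm] using norm_le_sqrt_card_mul (norm_nonneg v.ofLp) (norm_le_pi_norm v.ofLp)

theorem norm_target_add_le_initBound (C : ℝ) (d : ℕ) (A : Vec n →L[ℝ] Vec m) (x : Vec n)
    (ε : Vec m) : ‖A x + ε‖ + C * ‖A‖ * √(n * Real.log d) ≤ initBound C d A x ε := by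
  rw [initBound, mul_add]
  linarith [norm_add_le (A x) ε, norm_le_sqrt_mul_supNorm (A x), norm_le_sqrt_mul_supNorm ε]

theorem norm_target_le_initBound (hC : 0 ≤ C) : ‖A x + ε‖ ≤ initBound C d A x ε :=
  (le_add_of_nonneg_right (by positivity)).trans (norm_target_add_le_initBound C d A x ε)

theorem IsKL.le_initLossBound (h : IsKL ψ r₀ ℓ)
    (hb : BddGradRatio ℓ (A x + ε) (initBound C d A x ε)) (hy0 : ℓ (A x + ε) = 0) {g : Vec n}
    (hg : ‖g‖ ≤ C * √(n * Real.log d)) : ℓ (A g) ≤ initLossBound C d A x ε ℓ := by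
  have hAg : ‖A g‖ ≤ C * ‖A‖ * √(n * Real.log d) :=
    (A.le_opNorm_of_le hg).trans_eq (by ring)
  have hρ := norm_target_add_le_initBound C d A x ε
  have hAg0 := norm_nonneg (A g)
  exact h.le_half_gradRatio_mul_sq hb hy0 (by linarith) (by linarith [norm_nonneg (A x + ε)])
    ((norm_sub_le _ _).trans (by linarith))

theorem IsKL.sigmaMin_le_psi_of_unique (h : IsKL ψ r₀ ℓ) (hA : A ≠ 0)
    (hb : BddGradRatio ℓ (A x + ε) (initBound C d A x ε)) (hy0 : ℓ (A x + ε) = 0)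
    (huniq : ∀ v, ℓ v = 0 → v = A x + ε) (hC : 1 ≤ C * √(n * Real.log d))
    (ha : initLossBound C d A x ε ℓ < r₀) : sigmaMin A ≤ ψ (initLossBound C d A x ε ℓ) := by
  have : NeZero m := ⟨fun hm => hA <| by subst hm; exact Subsingleton.elim _ _⟩
  have hnorm : ‖A‖ ≤ C * ‖A‖ * √(n * Real.log d) :=
    (le_mul_of_one_le_left (norm_nonneg A) hC).trans_eq (by ring)
  have hρ := norm_target_add_le_initBound C d A x ε
  calc sigmaMin A ≤ ‖A‖ := sigmaMin_le_norm hA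
    _ ≤ initBound C d A x ε := by linarith [norm_nonneg (A x + ε)]
    _ ≤ ψ (initLossBound C d A x ε ℓ) :=
        h.le_psi_of_unique hb hy0 (by linarith [norm_nonneg A]) huniq ha

end InitBound

section Radius

theorem nuOne_nonneg {γ L : ℝ} (hL : 0 < L) (hγ : 0 < γ) (h : γ ≤ 1 / L) : 0 ≤ nuOne γ L := by
  have h1 : γ * L ≤ 1 := (le_div_iff₀ hL).1 h
  have h2 : 0 < γ * L := mul_pos hγ hL
  exact div_nonneg (by linarith) (by linarith)

theorem nuOne_le_four {γ L : ℝ} (hL : 0 < L) (h : γ ≤ 1 / L) : nuOne γ L ≤ 4 := by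
  have h1 : γ * L ≤ 1 := (le_div_iff₀ hL).1 h
  rw [nuOne, div_le_iff₀ (by linarith)]
  linarith

theorem initCondition_of_bounds {m n k d : ℕ} {φ ψ : ℝ → ℝ} {B : ℝ≥0} {r₀ : ℝ} {ℓ : Vec m → ℝ}
    {A : Vec n →L[ℝ] Vec m} {u : Vec d} {θ : Param n k d} {a s K r : ℝ}
    (hφ : Differentiable ℝ φ) (hB : ∀ x, |deriv φ x| ≤ B) (hL : LipschitzWith B (deriv φ))
    (hKL : IsKL ψ r₀ ℓ) (hA : A ≠ 0) (hk : 0 < k) (hu : ‖u‖ = 1) (hθ : ∀ j, ‖column θ j‖ ≤ K)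
    (hs : 0 < s) (hhidden : s ≤ ‖hidden φ u θ‖ / √k) (hloss : ℓ (A (net φ u θ)) ≤ a) (ha : a < r₀)
    (hr : 8 * (ψ a / sigmaMin A) / s < r) (hrad : 2 * r * (B / √k * (2 + (K + r))) ≤ s) :
    InitCondition φ ψ r₀ ℓ A u θ := by
  have hn := dim_pos_of_ne_zero hA
  have hk' : (0 : ℝ) < √k := by positivity
  have hz : 0 < ‖hidden φ u θ‖ := (div_pos_iff_of_pos_right hk').1 (hs.trans_le hhidden)
  have hsσ := hhidden.trans (norm_hidden_div_sqrt_le_sigmaMin_jac hφ u hz hk hn)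
  have hσA := sigmaMin_pos_of_ne_zero hA
  have hψ : 0 ≤ ψ (ℓ (A (net φ u θ))) := hKL.psi_nonneg (hKL.nonneg _) (hloss.trans_lt ha)
  have hψa : ψ (ℓ (A (net φ u θ))) ≤ ψ a := hKL.psi_le_psi (hKL.nonneg _) hloss ha
  have hr0 : 0 < r := lt_of_le_of_lt (by have := hψ.trans hψa; positivity) hr
  refine ⟨fun w => (exists_jac_eq hφ u hz hk w).imp fun _ h => h.1, hs.trans_le hsσ,
    hloss.trans_lt ha, fun L γ hL0 hγ hγL => ?_⟩
  have hradius : radius' φ ψ ℓ A u θ γ L < r := by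
    have := nuOne_nonneg hL0 hγ hγL
    calc radius' φ ψ ℓ A u θ γ L ≤ 2 * 4 * ψ a / (sigmaMin A * s) := by
          unfold radius'
          gcongr
          · linarith
          · exact nuOne_le_four hL0 hγL
      _ = 8 * (ψ a / sigmaMin A) / s := by ring
      _ < r := hr
  calc ENNReal.ofReal (radius' φ ψ ℓ A u θ γ L) < ENNReal.ofReal r :=
        (ENNReal.ofReal_lt_ofReal_iff hr0).2 hradius
    _ ≤ radius (jac φ u) θ (sigmaMin (jac φ u θ)) :=
        le_radius_jac hφ hB hL u ((norm_nonneg _).trans (hθ ⟨0, hk⟩)) hθ hr0.le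
          (by simpa [hu] using hrad.trans hsσ)

end Radius

section Width

/-- The constant `M` for which `k ≥ M² n max(1, q)⁴` makes `8 q / s + 1` an admissible radius, when
the Jacobian is bounded below by `s` and the entries of `V` are bounded by `D`. -/
noncomputable def widthConst (B D s : ℝ) : ℝ := 2 * B * (8 / s + 1) * (2 + D + (8 / s + 1)) / s

theorem mul_sqrt_mul_max_sq_le_sqrt {M q n k : ℝ} (hn : 0 ≤ n) (hk : M ^ 2 * n ≤ k)
    (hkq : M ^ 2 * n * q ^ 4 ≤ k) : M * √n * max 1 q ^ 2 ≤ √k := by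
  refine Real.le_sqrt_of_sq_le ?_
  rw [mul_pow, mul_pow, Real.sq_sqrt hn, ← pow_mul]
  rcases max_choice 1 q with h | h <;> rw [h]
  · simpa using hk
  · exact hkq

theorem two_mul_radius_mul_le {B D s q N κ : ℝ} (hB : 0 ≤ B) (hD : 0 ≤ D) (hs : 0 < s)
    (hq : 0 ≤ q) (hN : 1 ≤ N) (hκ : 0 < κ) (h : widthConst B D s * N * max 1 q ^ 2 ≤ κ) :
    2 * (8 * q / s + 1) * (B / κ * (2 + (N * D + (8 * q / s + 1)))) ≤ s := by
  set α := 8 / s + 1 with hα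
  set Q := max 1 q
  have hQ : 1 ≤ Q := le_max_left _ _
  have hNQ : 1 ≤ N * Q := one_le_mul_of_one_le_of_one_le hN hQ
  have hα0 : 0 < α := by positivity
  have hr : 8 * q / s + 1 ≤ α * Q := by
    rw [hα, add_mul, one_mul, mul_div_right_comm]
    gcongr
    exact le_max_right _ _
  have hrN : 2 + (N * D + (8 * q / s + 1)) ≤ (2 + D + α) * (N * Q) := by
    have hDN : N * D ≤ D * (N * Q) :=
      (mul_comm N D).trans_le (by gcongr; exact le_mul_of_one_le_right (by positivity) hQ)
    have hαN : α * Q ≤ α * (N * Q) := by gcongr; exact le_mul_of_one_le_left (by positivity) hN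
    linarith
  calc 2 * (8 * q / s + 1) * (B / κ * (2 + (N * D + (8 * q / s + 1))))
      ≤ 2 * (α * Q) * (B / κ * ((2 + D + α) * (N * Q))) := by gcongr
    _ = s * (widthConst B D s * N * Q ^ 2) / κ := by
        rw [widthConst, ← hα]
        field_simp
    _ ≤ s := by
        rw [div_le_iff₀ hκ]
        gcongr

end Width

section Probability

theorem two_mul_exp_neg_le_inv {x y : ℝ} (hx : 2 ≤ x) (hy : 2 * Real.log x ≤ y) :
    2 * Real.exp (-y) ≤ x⁻¹ := by
  calc 2 * Real.exp (-y) ≤ x * Real.exp (-(2 * Real.log x)) := by gcongr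
    _ = x⁻¹ := by
        rw [← mul_neg, mul_comm (2 : ℝ), Real.exp_mul, Real.exp_neg, Real.exp_log (by linarith)]
        norm_num
        field_simp

theorem one_le_mul_sqrt_mul_log {n d : ℕ} {C : ℝ} (hC : 2 ≤ C) (hn : 0 < n) (hd : 2 ≤ d) :
    1 ≤ C * √(n * Real.log d) := by
  have hlog : Real.log 2 ≤ Real.log d := Real.log_le_log two_pos (by exact_mod_cast hd)
  have hhalf : 1 / 2 ≤ √(n * Real.log d) := by
    have hn1 : (1 : ℝ) ≤ n := by exact_mod_cast hn
    refine Real.le_sqrt_of_sq_le ?_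
    nlinarith [Real.log_two_gt_d9]
  nlinarith

theorem IsBoundedInit.measureReal_not_hidden_net_le_inv {Ω : Type*} [MeasurableSpace Ω]
    {P : Measure Ω} [IsProbabilityMeasure P] {n k d : ℕ} {D C : ℝ} {φ : ℝ → ℝ} {B : ℝ≥0}
    {u : Ω → Vec d} {W : Ω → Fin k → Fin d → ℝ} {V : Ω → Fin n → Fin k → ℝ}
    (h : IsBoundedInit P D u W V) (hφ : LipschitzWith B φ) (hc : 0 < secondMoment φ) (hD : 0 < D)
    (hn : 0 < n) (hk : 0 < k) (hd : 2 ≤ d) (hC : 0 ≤ C) (hDC : 6 * D ^ 2 * secondMoment φ ≤ C ^ 2)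
    (hnk : 4 * Var[fun x => φ x ^ 2; gaussianReal 0 1] / secondMoment φ ^ 2 * n ≤ k) :
    P.real {ω | ¬(k * secondMoment φ / 2 ≤ ‖hidden φ (u ω) (toParam (V ω) (W ω))‖ ^ 2 ∧
        ‖net φ (u ω) (toParam (V ω) (W ω))‖ ≤ C * √(n * Real.log d))} ≤
      (n : ℝ)⁻¹ + (d : ℝ)⁻¹ := by
  have hn' : (0 : ℝ) < n := Nat.cast_pos.2 hn
  have hk' : (0 : ℝ) < k := Nat.cast_pos.2 hk
  refine (h.measureReal_not_hidden_net_le hD.le hφ hc hk (by positivity)).trans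
    (add_le_add ?_ (two_mul_exp_neg_le_inv (by exact_mod_cast hd) ?_))
  · rw [← div_div, div_le_iff₀ hk', ← div_eq_inv_mul, le_div_iff₀ hn']
    exact hnk
  · rw [le_div_iff₀ (by positivity), mul_pow, Real.sq_sqrt (by positivity)]
    calc 2 * Real.log d * (3 * D ^ 2 * n * secondMoment φ)
        = 6 * D ^ 2 * secondMoment φ * (n * Real.log d) := by ring
      _ ≤ C ^ 2 * (n * Real.log d) := by gcongr

end Probability

theorem initCondition_of_hidden_net {m n k d : ℕ} {φ ψ : ℝ → ℝ} {B : ℝ≥0} {r₀ C D : ℝ}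
    {ℓ : Vec m → ℝ} {A : Vec n →L[ℝ] Vec m} {x : Vec n} {ε : Vec m} {u : Vec d}
    {V : Fin n → Fin k → ℝ} {W : Fin k → Fin d → ℝ} (hφ : Differentiable ℝ φ)
    (hB : ∀ x, |deriv φ x| ≤ B) (hL : LipschitzWith B (deriv φ)) (hc : 0 < secondMoment φ)
    (hA : A ≠ 0) (hKL : IsKL ψ r₀ ℓ) (hb : BddGradRatio ℓ (A x + ε) (initBound C d A x ε))
    (hy0 : ℓ (A x + ε) = 0) (ha : initLossBound C d A x ε ℓ < r₀) (hk : 0 < k) (hD : 0 ≤ D)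
    (hkn : widthConst B D √(secondMoment φ / 2) ^ 2 * n ≤ k)
    (hkq : widthConst B D √(secondMoment φ / 2) ^ 2 * n *
      (ψ (initLossBound C d A x ε ℓ) / sigmaMin A) ^ 4 ≤ k)
    (hu : ‖u‖ = 1) (hV : ∀ i j, |V i j| ≤ D)
    (hhidden : k * secondMoment φ / 2 ≤ ‖hidden φ u (toParam V W)‖ ^ 2)
    (hnet : ‖net φ u (toParam V W)‖ ≤ C * √(n * Real.log d)) :
    InitCondition φ ψ r₀ ℓ A u (toParam V W) := by
  have hn := dim_pos_of_ne_zero hA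
  have hk' : (0 : ℝ) < √k := by positivity
  have hloss := hKL.le_initLossBound hb hy0 hnet
  have hq : 0 ≤ ψ (initLossBound C d A x ε ℓ) / sigmaMin A :=
    div_nonneg (hKL.psi_nonneg ((hKL.nonneg _).trans hloss) ha) (sigmaMin_pos_of_ne_zero hA).le
  refine initCondition_of_bounds hφ hB hL hKL hA hk hu (norm_column_toParam_le hD hV W)
    (Real.sqrt_pos.2 (half_pos hc)) ?_ hloss ha (lt_add_one _)
    (two_mul_radius_mul_le B.coe_nonneg hD (Real.sqrt_pos.2 (half_pos hc)) hq
      (Real.one_le_sqrt.2 (by exact_mod_cast hn)) hk'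
      (mul_sqrt_mul_max_sq_le_sqrt n.cast_nonneg hkn hkq))
  rw [le_div_iff₀ hk', ← Real.sqrt_mul (by positivity)]
  exact Real.sqrt_le_iff.2 ⟨norm_nonneg _, by linarith⟩

end DIP

open DIP in
theorem corollary1_general (φ : ℝ → ℝ) (hφ : IsActivation φ) (hφ0 : ∃ t, φ t ≠ 0) (D : ℝ) :
    ∃ C C' : ℝ, 0 < C ∧ 0 < C' ∧
      ∀ (m n k d : ℕ) (A : Vec n →L[ℝ] Vec m) (x : Vec n) (ε : Vec m) (ℓ : Vec m → ℝ) (ψ : ℝ → ℝ)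
        (r₀ : ℝ), A ≠ 0 → BddGradRatio ℓ (A x + ε) (initBound C d A x ε) → IsKL ψ r₀ ℓ →
        ℓ (A x + ε) = 0 → initLossBound C d A x ε ℓ < r₀ →
        C' * (sigmaMin A)⁻¹ ^ 4 * n * ψ (initLossBound C d A x ε ℓ) ^ 4 ≤ k →
        ((∀ v, ℓ v = 0 → v = A x + ε) ∨ C' * n ≤ k) →
        ∀ {Ω : Type*} [MeasurableSpace Ω] (P : Measure Ω) [IsProbabilityMeasure P]
          (u : Ω → Vec d) (W : Ω → Fin k → Fin d → ℝ) (V : Ω → Fin n → Fin k → ℝ),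
          IsBoundedInit P D u W V →
          ∃ E : Set Ω, MeasurableSet E ∧ 1 - (n : ℝ)⁻¹ - (d : ℝ)⁻¹ ≤ P.real E ∧
            ∀ ω ∈ E, InitCondition φ ψ r₀ ℓ A (u ω) (toParam (V ω) (W ω)) := by
  obtain ⟨hC1, B, -, hB, hL⟩ := hφ
  have hdiff : Differentiable ℝ φ := hC1.differentiable one_ne_zero
  have hLip : LipschitzWith B φ := lipschitzWith_of_nnnorm_deriv_le hdiff hB
  have hc : 0 < secondMoment φ :=
    integral_sq_gaussianReal_pos hLip (Function.ne_iff.2 hφ0) one_ne_zero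
  set D₁ := max D 1
  set v := Var[fun x => φ x ^ 2; gaussianReal 0 1]
  set M := widthConst B D₁ √(secondMoment φ / 2)
  set C := 2 + 6 * D₁ ^ 2 * secondMoment φ
  set C' := 1 + 4 * v / secondMoment φ ^ 2 + M ^ 2
  have hD₁ : 0 < D₁ := lt_max_of_lt_right one_pos
  have hv : 0 ≤ 4 * v / secondMoment φ ^ 2 :=
    div_nonneg (mul_nonneg zero_le_four (variance_nonneg _ _)) (sq_nonneg _)
  have hC2 : 2 ≤ C := le_add_of_nonneg_right (by positivity)
  refine ⟨C, C', by positivity, by positivity, ?_⟩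
  intro m n k d A x ε ℓ ψ r₀ hA hb hKL hy0 ha hk hor Ω _ P _ u W V h
  have hn := dim_pos_of_ne_zero hA
  obtain rfl | hd : d = 1 ∨ 2 ≤ d := by have := h.dim_pos; omega
  · exact ⟨∅, .empty, by simp, by simp⟩
  set q := ψ (initLossBound C d A x ε ℓ) / sigmaMin A with hq
  have hkq : C' * n * q ^ 4 ≤ k := hk.trans_eq' (by rw [hq, div_eq_mul_inv]; ring)
  have hkn : C' * n ≤ k := hor.elim (fun huniq => hkq.trans' <|
    le_mul_of_one_le_right (by positivity) <| one_le_pow₀ <|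
      (one_le_div (sigmaMin_pos_of_ne_zero hA)).2 <| hKL.sigmaMin_le_psi_of_unique hA hb hy0 huniq
        (one_le_mul_sqrt_mul_log hC2 hn hd) ha) id
  have hk0 : 0 < k := Nat.cast_pos.1 (hkn.trans_lt' (by positivity))
  have hMC : M ^ 2 ≤ C' := by linarith
  have hvC : 4 * v / secondMoment φ ^ 2 ≤ C' := by linarith [sq_nonneg M]
  simp only [sub_sub]
  refine exists_measurableSet_of_measureReal_not_le
    ((h.mono (le_max_left D 1)).measureReal_not_hidden_net_le_inv hLip hc hD₁ hn hk0 hd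
      (C := C) (by positivity) (by nlinarith) (hkn.trans' (by gcongr))) ?_
  filter_upwards [h.norm_input, h.V_bdd] with ω hu hV hgood
  exact initCondition_of_hidden_net hdiff hB hL hc hA hKL hb hy0 ha hk0 hD₁.le
    (hkn.trans' (by gcongr)) (hkq.trans' (by gcongr)) hu
    (fun i j => (hV i j).trans (le_max_left D 1)) hgood.1 hgood.2

theorem corollary1 (φ : ℝ → ℝ) (hφ : DIP.IsActivation φ) (hφ0 : ∃ t, φ t ≠ 0) (D : ℝ) :
    ∃ C C' : ℝ, 0 < C ∧ 0 < C' ∧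
      ∀ (m n k d : ℕ) (A : DIP.Vec n →L[ℝ] DIP.Vec m) (x : DIP.Vec n) (ε : DIP.Vec m)
        (ℓ : DIP.Vec m → ℝ) (ψ : ℝ → ℝ) (r₀ : ℝ),
        A ≠ 0 →
        -- assumptions on the loss
        (∀ S : Set (DIP.Vec m), Bornology.IsBounded S →
          ∃ K : ℝ≥0, LipschitzOnWith K (gradient ℓ) S) →
        DIP.IsKL ψ r₀ ℓ →
        ℓ (A x + ε) = 0 →
        -- `ψ` is defined at the point where the bound on `k` evaluates it
        DIP.initLossBound C d A x ε ℓ < r₀ →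
        -- the overparametrization bound
        C' * (DIP.sigmaMin A)⁻¹ ^ 4 * n * ψ (DIP.initLossBound C d A x ε ℓ) ^ 4 ≤ k →
        ((∀ v, ℓ v = 0 → v = A x + ε) ∨ C' * n ≤ k) →
        ∀ {Ω : Type*} [MeasurableSpace Ω] (P : Measure Ω) [IsProbabilityMeasure P]
          (u : Ω → DIP.Vec d) (W : Ω → Fin k → Fin d → ℝ) (V : Ω → Fin n → Fin k → ℝ),
          DIP.IsInit P D u W V →
          ∃ E : Set Ω, MeasurableSet E ∧
            1 - 2 * (n : ℝ)⁻¹ - (d : ℝ)⁻¹ ≤ P.real E ∧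
            ∀ ω ∈ E, DIP.InitCondition φ ψ r₀ ℓ A (u ω) (DIP.toParam (V ω) (W ω)) := by
  obtain ⟨C, C', hC, hC', hmain⟩ := corollary1_general φ hφ hφ0 D
  refine ⟨C, C', hC, hC', fun m n k d A x ε ℓ ψ r₀ hA hlip hKL hy0 ha hk hor Ω _ P _ u W V h => ?_⟩
  obtain ⟨K, hK⟩ := hlip _ isBounded_closedBall
  obtain ⟨E, hE, hPE, hgood⟩ := hmain m n k d A x ε ℓ ψ r₀ hA (DIP.bddGradRatio_of_lipschitzOnWith
    hK (DIP.norm_target_le_initBound hC.le) (hKL.gradient_eq_zero hy0)) hKL hy0 ha hk hor P u W V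
    h.isBoundedInit
  exact ⟨E, hE, by linarith [inv_nonneg.2 (n.cast_nonneg : (0 : ℝ) ≤ n)], hgood⟩
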